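/- **Setting.** A real random variable $\eta$ is *sub-Gaussian with parameter $c$* if $P(|\eta|>t)\le e\,P(|\xi|>t)$ for all $t\ge 0$, where $\xi\sim\mathcal N(0,c^2)$. An $m\times k$ random matrix is *sub-Gaussian with parameter $c$, mean zero and unit variance* if its entries are independent, sub-Gaussian with parameter $c$, and have mean $0$ and variance $1$. For an integer $L\ge1$ and $\delta>0$ let $\mathcal A=\{\pm(2j+1)\delta/2:\ 0\le j\le L-1\}$ and let $Q:\mathbb R\to\mathcal A$ map each real number to a nearest element of $\mathcal A$ (ties broken arbitrarily). Let $r\ge 0$, $d\ge r$, $g=(g_0,\dots,g_d)\in\mathbb R^{d+1}$ with $g_0=1$, and $h=\delta^{(0)}-\Delta^r g$, where $\delta^{(0)}$ is the Kronecker delta, $(\Delta a)_i=a_i-a_{i-1}$, and $g$ is extended by zero. The $r$-th order, $2L$-level $\Sigma\Delta$ scheme given by $g$ and $Q$ maps $y\in\mathbb R^m$ to $q=Q^{(r)}(y)\in\mathcal A^m$, where $$q_i=Q\big((h*v)_i+y_i\big),\qquad v_i=(h*v)_i+y_i-q_i\qquad(1\le i\le m),\qquad v_i=0\ (i\le 0);$$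 its state vector is $u=g*v$. For $\mu>0$ and $A>0$ the scheme *satisfies the stability bound at level $\mu$ with constant $A$* if for every $y\in\mathbb R^m$ with $\|y\|_\infty\le\mu$ $$\|u\|_\infty\le A\,C_3^{\,r}\,r^r\,\frac{\delta}{2},\qquad C_3=\Big\lceil\frac{\pi^2}{(\cosh^{-1}\gamma)^2}\Big\rceil\frac e\pi,\qquad \gamma=2L-\frac{2\mu}{\delta}.$$ Let $D$ be the $m\times m$ matrix with $D_{ii}=1$, $D_{i+1,i}=-1$ and all other entries $0$. The $r$-th order Sobolev dual of an $m\times k$ matrix $E$ of full column rank is $F=(D^{-r}E)^\dagger D^{-r}$, where $B^\dagger=(B^*B)^{-1}B^*$; it satisfies $FE=I$. **Theorem 4.3.** For every $c>0$ there are constants $C_{12},C_{13},C_{14}>0$ depending only on $c$ and, for every $A>0$, a constant $C_{15}>0$ depending only on $c$ and $A$, such that the following holds. Let $\widetilde E$ be an $m\times k$ sub-Gaussian matrix with mean zero, unit variance and parameter $c$, where $k\ge1$, let $E=\frac1{\sqrt m}\widetilde E$, and suppose that $\lambda:=m/k\ge C_{12}$. Put $r^*=\lfloor 2C_{13}\lambda^{1/2}\rfloor$,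 let $$\delta>\frac{4e^{1/2}}{\lambda^{1/4}L},$$ and let $Q^{(r^*)}$ be a $2L$-level $\Sigma\Delta$ scheme of order $r^*$ as above that satisfies the stability bound at level $\mu=e^{1/2}\lambda^{-1/4}$ with constant $A$. Then, with probability exceeding $1-3e^{-C_{14}\sqrt{mk}}$ on the draw of $E$, the matrix $E$ has full column rank and its $r^*$-th order Sobolev dual $F$ satisfies $$\|x-FQ^{(r^*)}(Ex)\|_2\le C_{15}\sqrt k\,e^{-C_{13}\lambda^{1/2}}\,\delta$$ uniformly for all $x\in\mathbb R^k$ with $\|x\|_2\le1$. If the entries of $\widetilde E$ are bounded in absolute value by a constant $K$ almost surely, then the same conclusion, with the same constants $C_{12},\dots,C_{15}$, holds under the relaxed condition $\delta>\frac{4K}{L}\lambda^{-1/2}$, for schemes that satisfy the stability bound at level $\mu=K\lambda^{-1/2}$ with constant $A$. -/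

import Mathlib

open MeasureTheory ProbabilityTheory Matrix

noncomputable section

namespace SigmaDelta

/-! Sub-Gaussian random matrices -/

/-- A real random variable `η` is sub-Gaussian with parameter `c` if it is `e`-dominated by
`N(0, c²)`: `P(|η| > t) ≤ e · P(|ξ| > t)` for all `t ≥ 0`, where `ξ ∼ N(0, c²)`. -/
def IsSubGaussianVar {Ω : Type*} [MeasurableSpace Ω] (P : Measure Ω) (η : Ω → ℝ) (c : ℝ) : Prop :=
  ∀ t : ℝ, 0 ≤ t →
    P {ω | t < |η ω|} ≤
      ENNReal.ofReal (Real.exp 1) * gaussianReal 0 (Real.toNNReal (c ^ 2)) {z | t < |z|}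

/-- A random matrix is sub-Gaussian with parameter `c`, mean `mean` and variance `var` if its
entries are independent sub-Gaussian random variables with these parameters. -/
structure IsSubGaussianMatrix {Ω : Type*} [MeasurableSpace Ω] (P : Measure Ω) {m k : ℕ}
    (E : Ω → Matrix (Fin m) (Fin k) ℝ) (c mean var : ℝ) : Prop where
  measurable : ∀ i j, Measurable fun ω => E ω i j
  indep : iIndepFun (fun (p : Fin m × Fin k) (ω : Ω) => E ω p.1 p.2) P
  subGaussian : ∀ i j, IsSubGaussianVar P (fun ω => E ω i j) c
  mean_eq : ∀ i j, ∫ ω, E ω i j ∂P = mean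
  variance_eq : ∀ i j, variance (fun ω => E ω i j) P = var

/-! The mid-rise alphabet and its scalar quantizer -/

/-- The `2L`-level mid-rise alphabet with step size `δ`. -/
def midrise (L : ℕ) (δ : ℝ) : Set ℝ :=
  {a | ∃ j : ℕ, j < L ∧ (a = (2 * j + 1) * δ / 2 ∨ a = -((2 * j + 1) * δ / 2))}

/-- `Q` is a scalar quantizer for the alphabet `𝒜`: it rounds every real number to a nearest
element of `𝒜` (ties may be broken in any way). -/
def IsScalarQuantizer (𝒜 : Set ℝ) (Q : ℝ → ℝ) : Prop :=
  ∀ t : ℝ, Q t ∈ 𝒜 ∧ ∀ a ∈ 𝒜, |t - Q t| ≤ |t - a|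

/-! Causal sequences: `a : ℕ → ℝ` is understood to vanish at negative times. The `i`-th
sample of an input of length `m`, `i = 1, …, m`, sits at time `i - 1`. -/

/-- Extension of a finite vector by zero. -/
def zeroExtend {n : ℕ} (a : Fin n → ℝ) : ℕ → ℝ :=
  fun i => if hi : i < n then a ⟨i, hi⟩ else 0

/-- The backward difference `(Δ a)_i = a_i - a_{i-1}` of a causal sequence. -/
def bdiff (a : ℕ → ℝ) : ℕ → ℝ
  | 0 => a 0
  | i + 1 => a (i + 1) - a i

/-- The convolution `(a * b)_i = ∑_{j=0}^{i} a_j b_{i-j}` of causal sequences. -/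
def cconv (a b : ℕ → ℝ) : ℕ → ℝ :=
  fun i => ∑ j ∈ Finset.range (i + 1), a j * b (i - j)

/-- The filter `h = δ⁽⁰⁾ - Δ^r g`, where `δ⁽⁰⁾` is the Kronecker delta. -/
def noiseFilter (r : ℕ) (g : ℕ → ℝ) : ℕ → ℝ :=
  fun i => (if i = 0 then 1 else 0) - bdiff^[r] g i

/-- The sequence `v` of the scheme `q_i = Q((h * v)_i + y_i)`, `v_i = (h * v)_i + y_i - q_i`,
for a filter with `h_0 = 0`, so that `(h * v)_i` only involves `v_0, …, v_{i-1}`. -/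
def stateV (Q : ℝ → ℝ) (h y : ℕ → ℝ) : ℕ → ℝ
  | i =>
    (∑ j : Fin i, h (i - j) * stateV Q h y j) + y i
      - Q ((∑ j : Fin i, h (i - j) * stateV Q h y j) + y i)
termination_by i => i
decreasing_by all_goals exact j.2

/-- The `r`-th order `ΣΔ` quantization `y ↦ q` of inputs of length `m` attached to `g`. -/
def quantize {m d : ℕ} (Q : ℝ → ℝ) (r : ℕ) (g : Fin (d + 1) → ℝ) (y : Fin m → ℝ) :
    Fin m → ℝ :=
  let h := noiseFilter r (zeroExtend g)
  let v := stateV Q h (zeroExtend y)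
  fun i => Q (cconv h v i + y i)

/-- The original state vector `u = g * v` of the scheme run on the input `y`. -/
def stateU {m d : ℕ} (Q : ℝ → ℝ) (r : ℕ) (g : Fin (d + 1) → ℝ) (y : Fin m → ℝ) :
    Fin m → ℝ :=
  let v := stateV Q (noiseFilter r (zeroExtend g)) (zeroExtend y)
  fun i => cconv (zeroExtend g) v i

theorem bdiff_iterate_zero (r : ℕ) (g : ℕ → ℝ) : bdiff^[r] g 0 = g 0 := by
  induction r generalizing g with
  | zero => rfl
  | succ r ih => rw [Function.iterate_succ_apply, ih]; rfl

theorem cconv_eq_sum (h v : ℕ → ℝ) (h0 : h 0 = 0) (i : ℕ) :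
    cconv h v i = ∑ j : Fin i, h (i - j) * v j := by
  rw [cconv, ← Finset.sum_range_reflect, Finset.sum_range_succ]
  simp only [Nat.add_sub_cancel, Nat.sub_self, h0, zero_mul, add_zero]
  rw [Finset.sum_range]
  refine Finset.sum_congr rfl fun j _ => ?_
  have hj := j.2
  rw [Nat.sub_sub_self hj.le]

/-- If `g_0 = 1`, then `v` satisfies the defining recursion `v_i = (h * v)_i + y_i - q_i`. -/
theorem stateV_eq {m d : ℕ} (Q : ℝ → ℝ) (r : ℕ) (g : Fin (d + 1) → ℝ) (hg : g 0 = 1)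
    (y : Fin m → ℝ) (i : Fin m) :
    stateV Q (noiseFilter r (zeroExtend g)) (zeroExtend y) i =
      cconv (noiseFilter r (zeroExtend g)) (stateV Q (noiseFilter r (zeroExtend g)) (zeroExtend y)) i
        + y i - quantize Q r g y i := by
  have h0 : noiseFilter r (zeroExtend g) 0 = 0 := by
    have hz : zeroExtend g 0 = 1 := by
      have : (⟨0, Nat.succ_pos d⟩ : Fin (d + 1)) = 0 := rfl
      simp [zeroExtend, this, hg]
    simp [noiseFilter, bdiff_iterate_zero, hz]
  have hy : zeroExtend y i = y i := by simp [zeroExtend]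
  simp only [quantize, cconv_eq_sum _ _ h0]
  rw [stateV, hy]

/-- The constant `C₃ = ⌈π² / (cosh⁻¹ γ)²⌉ · e / π`, where `γ = 2L - 2μ/δ`. -/
def stabConst (L : ℕ) (δ μ : ℝ) : ℝ :=
  (⌈Real.pi ^ 2 / Real.arcosh (2 * L - 2 * μ / δ) ^ 2⌉₊ : ℝ) * (Real.exp 1 / Real.pi)

/-- The stability bound of Güntürk and Deift et al.: the state vector satisfies
`‖u‖_∞ ≤ A C₃^r r^r δ/2` for all inputs of length `m` with `‖y‖_∞ ≤ μ`. -/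
def SatisfiesStabilityBound (m : ℕ) {d : ℕ} (Q : ℝ → ℝ) (r : ℕ) (g : Fin (d + 1) → ℝ)
    (L : ℕ) (δ μ A : ℝ) : Prop :=
  ∀ y : Fin m → ℝ, (∀ i, |y i| ≤ μ) →
    ∀ i, |stateU Q r g y i| ≤ A * stabConst L δ μ ^ r * (r : ℝ) ^ r * (δ / 2)

/-! Sobolev duals -/

/-- The `m × m` difference matrix. -/
def diffMatrix (m : ℕ) : Matrix (Fin m) (Fin m) ℝ :=
  Matrix.of fun i j => if i = j then 1 else if (i : ℕ) = j + 1 then -1 else 0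

/-- The Moore-Penrose left inverse `A† = (A* A)⁻¹ A*` of a matrix of full column rank. -/
def leftInv {m k : ℕ} (A : Matrix (Fin m) (Fin k) ℝ) : Matrix (Fin k) (Fin m) ℝ :=
  (Aᵀ * A)⁻¹ * Aᵀ

/-- The `r`-th order Sobolev dual `(D^{-r} E)† D^{-r}` of `E`. -/
def sobolevDual {m k : ℕ} (r : ℕ) (E : Matrix (Fin m) (Fin k) ℝ) : Matrix (Fin k) (Fin m) ℝ :=
  leftInv ((diffMatrix m ^ r)⁻¹ * E) * (diffMatrix m ^ r)⁻¹

/-- The `r`-th order Sobolev dual `F` of `E` is a dual frame (`F E = I`), and reconstruction by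
`F` from the `ΣΔ` quantization of `E x` has error at most `ε`, for all `‖x‖₂ ≤ 1`. -/
def ReconstructsWithin {m k d : ℕ} (Q : ℝ → ℝ) (r : ℕ) (g : Fin (d + 1) → ℝ)
    (E : Matrix (Fin m) (Fin k) ℝ) (ε : ℝ) : Prop :=
  sobolevDual r E * E = 1 ∧
    ∀ x : EuclideanSpace ℝ (Fin k), ‖x‖ ≤ 1 →
      ‖x - WithLp.toLp 2 (sobolevDual r E *ᵥ quantize Q r g (E *ᵥ x.ofLp))‖ ≤ ε

/-- `S` holds with probability exceeding `p`: it holds on a measurable event of probability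
greater than `p`. -/
def WithProbExceeding {Ω : Type*} [MeasurableSpace Ω] (P : Measure Ω) (p : ℝ)
    (S : Ω → Prop) : Prop :=
  ∃ G : Set Ω, MeasurableSet G ∧ p < P.real G ∧ ∀ ω ∈ G, S ω

end SigmaDelta

end

namespace SigmaDelta

/-! ### The scheme as a difference equation -/

/-! The scheme satisfies $y-q=D^ru$, so with $y=Ex$ and $FE=I$ the error is
$x-Fq=FD^ru=(D^{-r}E)^\dagger u$. Its norm is at most $\sqrt m\,\|u\|_\infty/\sigma_{\min}(D^{-r}E)$
(`reconstructsWithin_of_bounds`). Two probabilistic facts are needed: the rows of $\widetilde E$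
have norm at most $\sqrt m\,\mu$, so that $\|Ex\|_\infty\le\mu$ and the stability bound applies, and
$\sigma_{\min}(D^{-r}E)$ is large.

The singular values of $D^{-r}$ are never computed. Instead one takes an $n$-dimensional space $W$
of low-frequency vectors, $n\approx\sqrt{mk}$, on which $(D^*)^r$ has norm at most $\beta=(4\pi
n/m)^r$ (`exists_orthonormal_lowFrequency`). Pairing $Ex=D^r(D^{-r}Ex)$ with the projection of $Ex$
to $W$ gives $\|P_WEx\|\le\beta\|D^{-r}Ex\|$ (`norm_compress_le`). It remains to bound
$P_W\widetilde E$ below, effectively an $n\times k$ matrix with $n\ge Rk$.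

For a fixed unit $x$, $P_W\widetilde Ex=\sum_i\eta_ip_i$ with independent $\eta_i$ of unit variance
and a Parseval frame $(p_i)$. The coordinates of this vector in $W$ are in general dependent, so its
small-ball estimate comes from the Laplace transform $\mathbb E\exp(-s\|\sum\eta_ip_i\|^2)$,
integrated one $\eta_i$ at a time (`lintegral_exp_neg_quadraticForm_le`). A net argument with an
upper bound on the operator norm makes it uniform in $x$ (`exists_measure_compress_lt_le`).

With $z=\lambda^{1/2}$ and $r\approx2Cz$, the error contains $(4\pi n/m\cdot C_3r)^r$. Its base is
at most $e^{-2}$ when $C$ is small, so the power decays like $e^{-4Cz}$ and absorbs the polynomial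
prefactor (`error_le`). -/

theorem bdiff_cconv (a b : ℕ → ℝ) : bdiff (cconv a b) = cconv (bdiff a) b := by
  funext i
  cases i with
  | zero => simp [bdiff, cconv]
  | succ i =>
    change cconv a b (i + 1) - cconv a b i = cconv (bdiff a) b (i + 1)
    simp only [cconv]
    rw [Finset.sum_range_succ', Finset.sum_range_succ' (fun j => bdiff a j * b (i + 1 - j))]
    simp only [bdiff, Nat.add_sub_add_right, sub_mul, Finset.sum_sub_distrib]
    ring

theorem bdiff_iterate_cconv (r : ℕ) (a b : ℕ → ℝ) :
    bdiff^[r] (cconv a b) = cconv (bdiff^[r] a) b := by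
  induction r generalizing a with
  | zero => rfl
  | succ r ih => rw [Function.iterate_succ_apply, bdiff_cconv, ih, Function.iterate_succ_apply]

/-- Differences commute with convolution, so $h*v=v-\Delta^r(g*v)$. This turns the recursion for $v$
into $y-q=\Delta^ru$. -/
theorem cconv_noiseFilter (r : ℕ) (g v : ℕ → ℝ) (i : ℕ) :
    cconv (noiseFilter r g) v i = v i - bdiff^[r] (cconv g v) i := by
  rw [bdiff_iterate_cconv]
  simp only [cconv, noiseFilter, sub_mul, Finset.sum_sub_distrib]
  congr 1
  rw [Finset.sum_eq_single 0] <;> simp +contextual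

theorem diffMatrix_mulVec {m : ℕ} (w : ℕ → ℝ) :
    (diffMatrix m *ᵥ fun i : Fin m => w i) = fun i : Fin m => bdiff w i := by
  funext i
  obtain ⟨i, hi⟩ := i
  simp only [Matrix.mulVec, dotProduct, diffMatrix, Matrix.of_apply, Fin.ext_iff]
  cases i with
  | zero =>
    rw [Finset.sum_eq_single ⟨0, hi⟩]
    · simp [bdiff]
    · intro j _ hj
      have : (0 : ℕ) ≠ j := fun h => hj (Fin.ext h.symm)
      simp [this]
    · simp
  | succ i =>
    have hi' : i < m := by omega
    rw [Finset.sum_eq_add (⟨i + 1, hi⟩ : Fin m) ⟨i, hi'⟩ (by simp)]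
    · simp [bdiff, sub_eq_add_neg]
    · rintro j - ⟨h1, h2⟩
      have h1' : i + 1 ≠ (j : ℕ) := fun h => h1 (Fin.ext h.symm)
      have h2' : i ≠ (j : ℕ) := fun h => h2 (Fin.ext h.symm)
      simp [h1', h2']
    · simp
    · simp

theorem diffMatrix_pow_mulVec {m : ℕ} (r : ℕ) (w : ℕ → ℝ) :
    (diffMatrix m ^ r *ᵥ fun i : Fin m => w i) = fun i : Fin m => bdiff^[r] w i := by
  induction r generalizing w with
  | zero => simp
  | succ r ih =>
    rw [pow_succ, ← Matrix.mulVec_mulVec, diffMatrix_mulVec, ih, Function.iterate_succ_apply]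

/-- The quantization error of the scheme is the `r`-th difference of its state vector. -/
theorem sub_quantize_eq {m d : ℕ} (Q : ℝ → ℝ) (r : ℕ) (g : Fin (d + 1) → ℝ) (hg : g 0 = 1)
    (y : Fin m → ℝ) :
    y - quantize Q r g y = diffMatrix m ^ r *ᵥ stateU Q r g y := by
  have h := diffMatrix_pow_mulVec (m := m) r
    (cconv (zeroExtend g) (stateV Q (noiseFilter r (zeroExtend g)) (zeroExtend y)))
  have hU : stateU Q r g y = fun i : Fin m =>
    cconv (zeroExtend g) (stateV Q (noiseFilter r (zeroExtend g)) (zeroExtend y)) i := rfl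
  rw [hU, h]
  funext i
  have h1 := stateV_eq Q r g hg y i
  rw [cconv_noiseFilter] at h1
  simp only [Pi.sub_apply]
  linarith

theorem det_diffMatrix (m : ℕ) : (diffMatrix m).det = 1 := by
  rw [Matrix.det_of_isLowerTriangular]
  · simp [diffMatrix]
  · intro i j hij
    have hij' : i < j := hij
    have h1 : i ≠ j := hij'.ne
    have h2 : (i : ℕ) ≠ j + 1 := by have := Fin.lt_def.1 hij'; omega
    simp [diffMatrix, h1, h2]

theorem isUnit_diffMatrix_pow (m r : ℕ) : IsUnit (diffMatrix m ^ r).det := by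
  simp [Matrix.det_pow, det_diffMatrix]

/-! ### Left inverses of matrices that are bounded below -/

theorem dotProduct_self_nonneg {n : ℕ} (z : Fin n → ℝ) : 0 ≤ z ⬝ᵥ z :=
  Finset.sum_nonneg fun i _ => mul_self_nonneg (z i)

theorem isUnit_transpose_mul_self {m k : ℕ} {B : Matrix (Fin m) (Fin k) ℝ} {s : ℝ} (hs : 0 < s)
    (hB : ∀ z : Fin k → ℝ, s * (z ⬝ᵥ z) ≤ (B *ᵥ z) ⬝ᵥ (B *ᵥ z)) : IsUnit (Bᵀ * B).det := by
  rw [isUnit_iff_ne_zero]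
  intro h
  obtain ⟨z, hz, hz0⟩ := Matrix.exists_mulVec_eq_zero_iff.2 h
  have h1 := hB z
  have h2 : (B *ᵥ z) ⬝ᵥ (B *ᵥ z) = z ⬝ᵥ ((Bᵀ * B) *ᵥ z) := by
    rw [← Matrix.mulVec_mulVec, Matrix.mulVec_transpose, dotProduct_comm z,
      ← Matrix.dotProduct_mulVec]
  rw [h2, hz0, dotProduct_zero] at h1
  have h3 : 0 ≤ z ⬝ᵥ z := dotProduct_self_nonneg z
  have h4 : z ⬝ᵥ z = 0 := by nlinarith
  exact hz (dotProduct_self_eq_zero.1 h4)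

theorem leftInv_mul_self {m k : ℕ} {B : Matrix (Fin m) (Fin k) ℝ} {s : ℝ} (hs : 0 < s)
    (hB : ∀ z : Fin k → ℝ, s * (z ⬝ᵥ z) ≤ (B *ᵥ z) ⬝ᵥ (B *ᵥ z)) : leftInv B * B = 1 := by
  rw [leftInv, Matrix.mul_assoc, Matrix.nonsing_inv_mul _ (isUnit_transpose_mul_self hs hB)]

/-- The vector $z=B^\dagger u$ solves the normal equations, so $Bz$ is the orthogonal projection of
$u$ and $\|Bz\|\le\|u\|$. -/
theorem leftInv_mulVec_le {m k : ℕ} {B : Matrix (Fin m) (Fin k) ℝ} {s : ℝ} (hs : 0 < s)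
    (hB : ∀ z : Fin k → ℝ, s * (z ⬝ᵥ z) ≤ (B *ᵥ z) ⬝ᵥ (B *ᵥ z)) (u : Fin m → ℝ) :
    s * ((leftInv B *ᵥ u) ⬝ᵥ (leftInv B *ᵥ u)) ≤ u ⬝ᵥ u := by
  set z := leftInv B *ᵥ u with hz
  refine (hB z).trans ?_
  have h1 : (Bᵀ * B) *ᵥ z = Bᵀ *ᵥ u := by
    rw [hz, leftInv, Matrix.mulVec_mulVec, ← Matrix.mul_assoc,
      Matrix.mul_nonsing_inv _ (isUnit_transpose_mul_self hs hB), Matrix.one_mul]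
  have h2 : (B *ᵥ z) ⬝ᵥ (B *ᵥ z) = (B *ᵥ z) ⬝ᵥ u := by
    have : (B *ᵥ z) ⬝ᵥ (B *ᵥ z) = z ⬝ᵥ ((Bᵀ * B) *ᵥ z) := by
      rw [← Matrix.mulVec_mulVec, Matrix.mulVec_transpose, dotProduct_comm z,
        ← Matrix.dotProduct_mulVec]
    rw [this, h1, Matrix.mulVec_transpose, dotProduct_comm z, ← Matrix.dotProduct_mulVec,
      dotProduct_comm]
  have h3 : 0 ≤ (u - B *ᵥ z) ⬝ᵥ (u - B *ᵥ z) := dotProduct_self_nonneg _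
  rw [sub_dotProduct, dotProduct_sub, dotProduct_sub, dotProduct_comm u (B *ᵥ z), ← h2] at h3
  linarith

theorem norm_toLp_sq {n : ℕ} (z : Fin n → ℝ) : ‖WithLp.toLp 2 z‖ ^ 2 = z ⬝ᵥ z := by
  rw [EuclideanSpace.real_norm_sq_eq, dotProduct]
  exact Finset.sum_congr rfl fun i _ => pow_two _

/-- Reconstruction by the Sobolev dual when the smoothed frame `D^{-r} E` is bounded below by
`σ` and the state vectors are bounded by `U`. -/
theorem reconstructsWithin_of_bounds {m k d : ℕ} (Q : ℝ → ℝ) (r : ℕ) (g : Fin (d + 1) → ℝ)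
    (hg : g 0 = 1) (E : Matrix (Fin m) (Fin k) ℝ) {σ U : ℝ} (hσ : 0 < σ) (hU : 0 ≤ U)
    (hB : ∀ z : Fin k → ℝ, σ ^ 2 * (z ⬝ᵥ z) ≤
      (((diffMatrix m ^ r)⁻¹ * E) *ᵥ z) ⬝ᵥ (((diffMatrix m ^ r)⁻¹ * E) *ᵥ z))
    (hu : ∀ x : EuclideanSpace ℝ (Fin k), ‖x‖ ≤ 1 → ∀ i, |stateU Q r g (E *ᵥ x.ofLp) i| ≤ U) :
    ReconstructsWithin Q r g E (√(m : ℝ) * U / σ) := by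
  have hσ2 : 0 < σ ^ 2 := by positivity
  have hFE : sobolevDual r E * E = 1 := by
    rw [sobolevDual, Matrix.mul_assoc, leftInv_mul_self hσ2 hB]
  refine ⟨hFE, fun x hx => ?_⟩
  set y := E *ᵥ x.ofLp with hy
  set u := stateU Q r g y with hudef
  have h1 : x - WithLp.toLp 2 (sobolevDual r E *ᵥ quantize Q r g y) =
      WithLp.toLp 2 (leftInv ((diffMatrix m ^ r)⁻¹ * E) *ᵥ u) := by
    have h2 : sobolevDual r E *ᵥ y = x.ofLp := by
      rw [hy, Matrix.mulVec_mulVec, hFE, Matrix.one_mulVec]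
    have h3 : leftInv ((diffMatrix m ^ r)⁻¹ * E) *ᵥ u =
        sobolevDual r E *ᵥ y - sobolevDual r E *ᵥ quantize Q r g y := by
      rw [← Matrix.mulVec_sub, sub_quantize_eq Q r g hg, Matrix.mulVec_mulVec, sobolevDual,
        Matrix.mul_assoc, Matrix.nonsing_inv_mul _ (isUnit_diffMatrix_pow m r), Matrix.mul_one]
    rw [h3, h2, WithLp.toLp_sub, WithLp.toLp_ofLp]
  rw [h1]
  have h4 := leftInv_mulVec_le hσ2 hB u
  rw [← norm_toLp_sq] at h4
  have h5 : u ⬝ᵥ u ≤ m * U ^ 2 := by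
    rw [dotProduct]
    calc ∑ i, u i * u i ≤ ∑ _i : Fin m, U ^ 2 := by
          refine Finset.sum_le_sum fun i _ => ?_
          rw [← pow_two, ← sq_abs]
          exact pow_le_pow_left₀ (abs_nonneg _) (hu x hx i) 2
      _ = m * U ^ 2 := by simp
  rw [le_div_iff₀ hσ]
  refine abs_le_of_sq_le_sq' ?_ (by positivity) |>.2
  rw [mul_pow, mul_pow, Real.sq_sqrt (Nat.cast_nonneg m)]
  linarith

/-! ### Low frequency vectors -/

/-- The cyclic forward difference `v_i - v_{i+1}`. -/
def cyclicDiff (m : ℕ) [NeZero m] :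
    EuclideanSpace ℝ (Fin m) →ₗ[ℝ] EuclideanSpace ℝ (Fin m) where
  toFun v := WithLp.toLp 2 fun i => v i - v (i + 1)
  map_add' v w := by ext i; simp; ring
  map_smul' c v := by ext i; simp; ring

/-- The cyclic backward difference `v_i - v_{i-1}`. -/
def cyclicDiffAdj (m : ℕ) [NeZero m] :
    EuclideanSpace ℝ (Fin m) →ₗ[ℝ] EuclideanSpace ℝ (Fin m) where
  toFun v := WithLp.toLp 2 fun i => v i - v (i - 1)
  map_add' v w := by ext i; simp; ring
  map_smul' c v := by ext i; simp; ring

theorem cyclicDiff_apply {m : ℕ} [NeZero m] (v : EuclideanSpace ℝ (Fin m)) (i : Fin m) :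
    cyclicDiff m v i = v i - v (i + 1) := rfl

theorem cyclicDiffAdj_apply {m : ℕ} [NeZero m] (v : EuclideanSpace ℝ (Fin m)) (i : Fin m) :
    cyclicDiffAdj m v i = v i - v (i - 1) := rfl

theorem inner_cyclicDiff {m : ℕ} [NeZero m] (v w : EuclideanSpace ℝ (Fin m)) :
    inner ℝ (cyclicDiff m v) w = inner ℝ v (cyclicDiffAdj m w) := by
  simp only [PiLp.inner_apply, cyclicDiff_apply, cyclicDiffAdj_apply, RCLike.inner_apply,
    conj_trivial, mul_sub, sub_mul, Finset.sum_sub_distrib]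
  congr 1
  refine Fintype.sum_equiv (Equiv.addRight 1) _ _ fun i => ?_
  simp

theorem inner_cyclicDiff_pow {m : ℕ} [NeZero m] (r : ℕ) (v w : EuclideanSpace ℝ (Fin m)) :
    inner ℝ ((cyclicDiff m ^ r) v) w = inner ℝ v ((cyclicDiffAdj m ^ r) w) := by
  induction r generalizing v w with
  | zero => simp
  | succ r ih =>
    rw [pow_succ', pow_succ, Module.End.mul_apply, inner_cyclicDiff, ih, Module.End.mul_apply]

/-- Both operators are polynomials in the cyclic shift and its inverse. Normality gives
$\|C^rv\|^2=\langle v,(C^*C)^rv\rangle$, which reduces powers of the difference to eigenvalues of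
the cyclic Laplacian. -/
theorem commute_cyclicDiff (m : ℕ) [NeZero m] : Commute (cyclicDiffAdj m) (cyclicDiff m) := by
  ext v i
  simp only [Module.End.mul_apply, cyclicDiff_apply, cyclicDiffAdj_apply, sub_add_cancel,
    add_sub_cancel_right]
  ring

/-- If `v` is a combination of orthonormal eigenvectors of the cyclic Laplacian with eigenvalues
at most `β²`, then each cyclic difference of `v` costs at most a factor `β`. -/
theorem norm_cyclicDiff_pow_le {m N : ℕ} [NeZero m] {e : Fin N → EuclideanSpace ℝ (Fin m)}
    (he : Orthonormal ℝ e) {ev : Fin N → ℝ} {β : ℝ} (hβ : 0 ≤ β)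
    (hev : ∀ j, (cyclicDiffAdj m * cyclicDiff m) (e j) = ev j • e j)
    (hpos : ∀ j, 0 ≤ ev j) (hle : ∀ j, ev j ≤ β ^ 2) (r : ℕ)
    {v : EuclideanSpace ℝ (Fin m)} (hv : v ∈ Submodule.span ℝ (Set.range e)) :
    ‖(cyclicDiff m ^ r) v‖ ≤ β ^ r * ‖v‖ := by
  obtain ⟨a, rfl⟩ := (Submodule.mem_span_range_iff_exists_fun ℝ).1 hv
  have hpow : ∀ j, ((cyclicDiffAdj m * cyclicDiff m) ^ r) (e j) = ev j ^ r • e j := by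
    intro j
    induction r with
    | zero => simp
    | succ r ih =>
      rw [pow_succ', Module.End.mul_apply, ih, map_smul, hev, smul_smul, pow_succ]
  have h1 : ‖(cyclicDiff m ^ r) (∑ j, a j • e j)‖ ^ 2 = ∑ j, a j * (ev j ^ r * a j) := by
    rw [← real_inner_self_eq_norm_sq, inner_cyclicDiff_pow, ← Module.End.mul_apply,
      ← (commute_cyclicDiff m).mul_pow, map_sum]
    simp only [map_smul, hpow, smul_smul]
    rw [he.inner_sum]
    exact Finset.sum_congr rfl fun j _ => by rw [conj_trivial]; ring
  have h2 : ‖∑ j, a j • e j‖ ^ 2 = ∑ j, a j * a j := by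
    rw [← real_inner_self_eq_norm_sq, he.inner_sum]
    simp
  refine abs_le_of_sq_le_sq' ?_ (by positivity) |>.2
  rw [h1, mul_pow, h2, Finset.mul_sum]
  refine Finset.sum_le_sum fun j _ => ?_
  have h3 : ev j ^ r ≤ (β ^ r) ^ 2 := by
    rw [← pow_mul, mul_comm r 2, pow_mul]
    exact pow_le_pow_left₀ (hpos j) (hle j) r
  nlinarith [mul_self_nonneg (a j)]

/-- Samples of a cosine with `j` periods. -/
noncomputable def cosVec (m : ℕ) (j : ℕ) : EuclideanSpace ℝ (Fin m) :=
  WithLp.toLp 2 fun i => Real.cos (2 * Real.pi * j / m * (i : ℕ))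

theorem cosVec_apply (m j : ℕ) (i : Fin m) :
    cosVec m j i = Real.cos (2 * Real.pi * j / m * (i : ℕ)) := rfl

theorem exists_val_add_one {m : ℕ} [NeZero m] (i : Fin m) :
    ∃ q : ℕ, ((i + 1 : Fin m) : ℕ) + m * q = (i : ℕ) + 1 := by
  refine ⟨((i : ℕ) + 1) / m, ?_⟩
  have : ((i + 1 : Fin m) : ℕ) = ((i : ℕ) + 1) % m := by
    rw [Fin.val_add, Fin.val_one', Nat.add_mod_mod]
  rw [this, Nat.mod_add_div]

theorem cosVec_add_one {m : ℕ} [NeZero m] (j : ℕ) (i : Fin m) :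
    cosVec m j (i + 1) = Real.cos (2 * Real.pi * j / m * ((i : ℕ) + 1 : ℝ)) := by
  obtain ⟨q, hq⟩ := exists_val_add_one i
  have hm : (m : ℝ) ≠ 0 := Nat.cast_ne_zero.2 (NeZero.ne m)
  have hq' : (((i + 1 : Fin m) : ℕ) : ℝ) + m * q = (i : ℕ) + 1 := by exact_mod_cast hq
  rw [cosVec_apply, ← hq', ← Real.cos_add_nat_mul_two_pi _ (j * q)]
  congr 1
  push_cast
  field_simp

theorem cosVec_sub_one {m : ℕ} [NeZero m] (j : ℕ) (i : Fin m) :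
    cosVec m j (i - 1) = Real.cos (2 * Real.pi * j / m * ((i : ℕ) - 1 : ℝ)) := by
  obtain ⟨q, hq⟩ := exists_val_add_one (i - 1)
  rw [sub_add_cancel] at hq
  have hm : (m : ℝ) ≠ 0 := Nat.cast_ne_zero.2 (NeZero.ne m)
  have hq' : ((i : ℕ) : ℝ) + m * q = ((i - 1 : Fin m) : ℕ) + 1 := by exact_mod_cast hq
  have hq2 : (((i - 1 : Fin m) : ℕ) : ℝ) = (i : ℕ) - 1 + m * q := by linarith
  rw [cosVec_apply, hq2, ← Real.cos_add_nat_mul_two_pi (2 * Real.pi * j / m * ((i : ℕ) - 1 : ℝ))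
    (j * q)]
  congr 1
  push_cast
  field_simp

theorem cyclicLaplacian_cosVec {m : ℕ} [NeZero m] (j : ℕ) :
    (cyclicDiffAdj m * cyclicDiff m) (cosVec m j) =
      (2 - 2 * Real.cos (2 * Real.pi * j / m)) • cosVec m j := by
  ext i
  simp only [Module.End.mul_apply, cyclicDiff_apply, cyclicDiffAdj_apply, sub_add_cancel,
    PiLp.smul_apply, smul_eq_mul]
  rw [cosVec_add_one, cosVec_sub_one, cosVec_apply, mul_add, mul_sub, mul_one, Real.cos_add,
    Real.cos_sub]
  ring

theorem cosVec_ne_zero (m : ℕ) [NeZero m] (j : ℕ) : cosVec m j ≠ 0 := by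
  intro h
  have h1 : cosVec m j 0 = 0 := by rw [h]; rfl
  simp [cosVec_apply] at h1

/-- Eigenvectors of a symmetric operator for distinct eigenvalues: up to half the sampling rate the
angles lie in $[0,\pi]$, where the cosine is injective. -/
theorem inner_cosVec_eq_zero {m i j : ℕ} [NeZero m] (hi : 2 * i ≤ m) (hj : 2 * j ≤ m)
    (hij : i ≠ j) : inner ℝ (cosVec m i) (cosVec m j) = 0 := by
  have hm : (0 : ℝ) < m := Nat.cast_pos.2 (Nat.pos_of_ne_zero (NeZero.ne m))
  have key : ∀ l : ℕ, 2 * l ≤ m → 2 * Real.pi * l / m ∈ Set.Icc 0 Real.pi := by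
    intro l hl
    have hl' : (2 * l : ℝ) ≤ m := by exact_mod_cast hl
    refine ⟨by positivity, ?_⟩
    rw [div_le_iff₀ hm]
    nlinarith [Real.pi_pos]
  have hne : Real.cos (2 * Real.pi * i / m) ≠ Real.cos (2 * Real.pi * j / m) := by
    intro h
    have h1 := Real.injOn_cos (key i hi) (key j hj) h
    have h2 : (i : ℝ) = j := by
      have := Real.pi_pos
      field_simp at h1
      linarith
    exact hij (by exact_mod_cast h2)
  have hsymm : inner ℝ ((cyclicDiffAdj m * cyclicDiff m) (cosVec m i)) (cosVec m j) =
      inner ℝ (cosVec m i) ((cyclicDiffAdj m * cyclicDiff m) (cosVec m j)) := by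
    rw [Module.End.mul_apply, Module.End.mul_apply, ← inner_cyclicDiff, real_inner_comm,
      ← inner_cyclicDiff, real_inner_comm]
  rw [cyclicLaplacian_cosVec, cyclicLaplacian_cosVec, real_inner_smul_left,
    real_inner_smul_right] at hsymm
  have h3 : (Real.cos (2 * Real.pi * i / m) - Real.cos (2 * Real.pi * j / m)) *
      inner ℝ (cosVec m i) (cosVec m j) = 0 := by linarith
  exact (mul_eq_zero.1 h3).resolve_left (sub_ne_zero.2 hne)

/-- $D^*$ and the cyclic difference differ only in the last coordinate, where the cyclic one reads
$v_0$. Each difference shortens the initial run of zeros by one, so $r$ zeros keep the wrap-around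
invisible for $r$ steps. -/
theorem transpose_diffMatrix_pow_mulVec {m : ℕ} [NeZero m] (r : ℕ)
    (v : EuclideanSpace ℝ (Fin m)) (hv : ∀ i : Fin m, (i : ℕ) < r → v i = 0) :
    ((diffMatrix m)ᵀ ^ r) *ᵥ v.ofLp = ((cyclicDiff m ^ r) v).ofLp := by
  induction r generalizing v with
  | zero => simp
  | succ r ih =>
    have hwrap : ∀ i : Fin m, (i : ℕ) + 1 = m → i + 1 = 0 := by
      intro i hi
      ext
      rw [Fin.val_add, Fin.val_one', Nat.add_mod_mod, hi]
      simp
    have hval : ∀ i : Fin m, (i : ℕ) + 1 < m → ((i + 1 : Fin m) : ℕ) = i + 1 := by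
      intro i hi
      rw [Fin.val_add, Fin.val_one', Nat.add_mod_mod, Nat.mod_eq_of_lt hi]
    have h0 : v 0 = 0 := hv 0 (by simp)
    have h1 : (diffMatrix m)ᵀ *ᵥ v.ofLp = (cyclicDiff m v).ofLp := by
      funext i
      rw [cyclicDiff_apply]
      simp only [Matrix.mulVec, dotProduct, Matrix.transpose_apply, diffMatrix, Matrix.of_apply]
      by_cases hi : (i : ℕ) + 1 < m
      · have hne : i ≠ i + 1 := fun h => by have := congrArg Fin.val h; rw [hval i hi] at this; omega
        rw [Finset.sum_eq_add i (i + 1) hne]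
        · simp [hne.symm, hval i hi, sub_eq_add_neg]
        · rintro j - ⟨hj1, hj2⟩
          have hj3 : (j : ℕ) ≠ i + 1 := fun h => hj2 (Fin.ext (by rw [hval i hi, h]))
          simp [hj1, hj3]
        · simp
        · simp
      · have hi' : (i : ℕ) + 1 = m := by omega
        rw [hwrap i hi', h0, Finset.sum_eq_single i]
        · simp
        · intro j _ hj
          have hj3 : (j : ℕ) ≠ i + 1 := by omega
          simp [hj, hj3]
        · simp
    rw [pow_succ, ← Matrix.mulVec_mulVec, h1, ih, pow_succ, Module.End.mul_apply]
    intro i hi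
    rw [cyclicDiff_apply, hv i (by omega), hv (i + 1), sub_zero]
    by_cases hi' : (i : ℕ) + 1 < m
    · rw [hval i hi']; omega
    · rw [hwrap i (by omega)]; simp

/-- There is an `n`-dimensional space of vectors on which the `r`-th power of the adjoint
difference operator has norm at most `(4πn/m)^r`. -/
theorem exists_orthonormal_lowFrequency {m n r : ℕ} (hn : 0 < n) (hr : r ≤ n) (hm : 4 * n ≤ m) :
    ∃ w : Fin n → EuclideanSpace ℝ (Fin m), Orthonormal ℝ w ∧
      ∀ v ∈ Submodule.span ℝ (Set.range w),
        ‖WithLp.toLp 2 (((diffMatrix m)ᵀ ^ r) *ᵥ v.ofLp)‖ ≤ (4 * Real.pi * n / m) ^ r * ‖v‖ := by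
  have : NeZero m := ⟨by omega⟩
  have hm0 : (0 : ℝ) < m := Nat.cast_pos.2 (by omega)
  -- Twice as many frequencies as needed: the $r\le n$ conditions $v_i=0$, $i<r$, still leave
  -- dimension at least $n$. The assumption $4n\le m$ keeps all frequencies below half the sampling
  -- rate.
  set e : Fin (2 * n) → EuclideanSpace ℝ (Fin m) :=
    fun j => ‖cosVec m j‖⁻¹ • cosVec m j with he_def
  have he : Orthonormal ℝ e := by
    refine ⟨fun j => norm_smul_inv_norm (𝕜 := ℝ) (cosVec_ne_zero m j), fun i j hij => ?_⟩
    change inner ℝ (‖cosVec m i‖⁻¹ • cosVec m i) (‖cosVec m j‖⁻¹ • cosVec m j) = 0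
    rw [real_inner_smul_left, real_inner_smul_right,
      inner_cosVec_eq_zero (by omega) (by omega) (fun h => hij (Fin.ext h))]
    simp
  set V := Submodule.span ℝ (Set.range e) with hV
  have hVrank : Module.finrank ℝ V = 2 * n := by
    rw [hV, finrank_span_eq_card he.linearIndependent, Fintype.card_fin]
  let f : V →ₗ[ℝ] (Fin r → ℝ) :=
    { toFun := fun v i => (v : EuclideanSpace ℝ (Fin m)) (Fin.castLE (by omega) i)
      map_add' := fun v w => rfl
      map_smul' := fun c v => rfl }
  have hker : n ≤ Module.finrank ℝ (LinearMap.ker f) := by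
    have h1 := LinearMap.finrank_range_add_finrank_ker f
    have h2 : Module.finrank ℝ (LinearMap.range f) ≤ r := by
      simpa using Submodule.finrank_le (LinearMap.range f)
    omega
  let b := stdOrthonormalBasis ℝ (LinearMap.ker f)
  let ι : LinearMap.ker f →ₗᵢ[ℝ] EuclideanSpace ℝ (Fin m) :=
    V.subtypeₗᵢ.comp (LinearMap.ker f).subtypeₗᵢ
  refine ⟨fun a => ι (b (Fin.castLE hker a)), ?_, fun v hv => ?_⟩
  · exact (b.orthonormal.comp_linearIsometry ι).comp _ (Fin.castLE_injective hker)
  · have hrange : v ∈ LinearMap.range ι.toLinearMap := by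
      refine Submodule.span_le.2 ?_ hv
      rintro _ ⟨a, rfl⟩
      exact ⟨_, rfl⟩
    obtain ⟨z, rfl⟩ := hrange
    have hz0 : ∀ i : Fin m, (i : ℕ) < r → ι z i = 0 := by
      intro i hi
      exact congrFun (LinearMap.mem_ker.1 z.2) ⟨i, hi⟩
    change ‖WithLp.toLp 2 (((diffMatrix m)ᵀ ^ r) *ᵥ (ι z).ofLp)‖ ≤ _ * ‖ι z‖
    rw [transpose_diffMatrix_pow_mulVec r (ι z) hz0, WithLp.toLp_ofLp]
    refine norm_cyclicDiff_pow_le he (ev := fun j => 2 - 2 * Real.cos (2 * Real.pi * (j : ℕ) / m))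
      (by positivity) (fun j => ?_) (fun j => ?_) (fun j => ?_) r z.1.2
    · rw [he_def]
      simp only [map_smul, cyclicLaplacian_cosVec]
      rw [smul_comm]
    · linarith [Real.cos_le_one (2 * Real.pi * (j : ℕ) / m)]
    · have h1 := Real.one_sub_sq_div_two_le_cos (x := 2 * Real.pi * (j : ℕ) / m)
      have h2 : 2 * Real.pi * (j : ℕ) / m ≤ 4 * Real.pi * n / m := by
        have : ((j : ℕ) : ℝ) ≤ 2 * n := by exact_mod_cast j.2.le
        gcongr ?_ / _
        nlinarith [Real.pi_pos]
      have h3 : (2 * Real.pi * (j : ℕ) / m) ^ 2 ≤ (4 * Real.pi * n / m) ^ 2 :=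
        pow_le_pow_left₀ (by positivity) h2 2
      linarith

/-! ### Nets -/

/-- A maximal $1$-separated subset of the ball of radius $2$ is a $1$-net of it, and a volume count
bounds its size by $5^{\dim F}$; scaling by $1/2$ gives the net. -/
theorem exists_half_net (F : Type*) [NormedAddCommGroup F] [NormedSpace ℝ F]
    [FiniteDimensional ℝ F] :
    ∃ s : Finset F, s.card ≤ 5 ^ Module.finrank ℝ F ∧ (∀ c ∈ s, ‖c‖ ≤ 1) ∧
      ∀ x : F, ‖x‖ ≤ 1 → ∃ c ∈ s, ‖x - c‖ ≤ 1 / 2 := by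
  classical
  let p : ℕ → Prop := fun N => ∃ t : Finset F, t.card = N ∧ (∀ c ∈ t, ‖c‖ ≤ 2) ∧
    ∀ c ∈ t, ∀ d ∈ t, c ≠ d → 1 ≤ ‖c - d‖
  have hp0 : p 0 := ⟨∅, by simp⟩
  have hbd : ∀ N, p N → N ≤ 5 ^ Module.finrank ℝ F := by
    rintro N ⟨t, rfl, h1, h2⟩
    exact Besicovitch.card_le_of_separated t h1 h2
  obtain ⟨t, htc, ht1, ht2⟩ := Nat.findGreatest_spec (Nat.zero_le _) hp0
    (n := 5 ^ Module.finrank ℝ F)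
  refine ⟨t.image fun c => (1 / 2 : ℝ) • c, ?_, ?_, fun x hx => ?_⟩
  · exact Finset.card_image_le.trans (hbd _ ⟨t, rfl, ht1, ht2⟩)
  · simp only [Finset.mem_image]
    rintro _ ⟨c, hc, rfl⟩
    rw [norm_smul, Real.norm_of_nonneg (by norm_num)]
    linarith [ht1 c hc]
  · suffices h : ∃ c ∈ t, ‖(2 : ℝ) • x - c‖ ≤ 1 by
      obtain ⟨c, hc, hxc⟩ := h
      refine ⟨_, Finset.mem_image_of_mem _ hc, ?_⟩
      have : x - (1 / 2 : ℝ) • c = (1 / 2 : ℝ) • ((2 : ℝ) • x - c) := by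
        rw [smul_sub, smul_smul]; norm_num
      rw [this, norm_smul, Real.norm_of_nonneg (by norm_num)]
      linarith
    by_contra! hcon
    have hnot : (2 : ℝ) • x ∉ t := fun h => by
      have := hcon _ h
      rw [sub_self, norm_zero] at this
      linarith
    have hbig : p (t.card + 1) := by
      refine ⟨insert ((2 : ℝ) • x) t, Finset.card_insert_of_notMem hnot, ?_, ?_⟩
      · intro c hc
        rcases Finset.mem_insert.1 hc with rfl | hc
        · rw [norm_smul, Real.norm_of_nonneg (by norm_num)]; linarith
        · exact ht1 c hc
      · intro c hc d hd hcd
        rcases Finset.mem_insert.1 hc with rfl | hc <;> rcases Finset.mem_insert.1 hd with rfl | hd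
        · exact absurd rfl hcd
        · exact (hcon d hd).le
        · rw [norm_sub_rev]; exact (hcon c hc).le
        · exact ht2 c hc d hd hcd
    have := Nat.le_findGreatest (hbd _ hbig) hbig
    omega

/-- Each refinement applies the half-net to the rescaled residual, so halving the mesh costs one
more factor $5^{\dim F}$. -/
theorem exists_dyadic_net (F : Type*) [NormedAddCommGroup F] [NormedSpace ℝ F]
    [FiniteDimensional ℝ F] (j : ℕ) :
    ∃ s : Finset F, s.card ≤ 5 ^ (j * Module.finrank ℝ F) ∧
      ∀ x : F, ‖x‖ ≤ 1 → ∃ c ∈ s, ‖x - c‖ ≤ (1 / 2) ^ j := by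
  classical
  induction j with
  | zero => exact ⟨{0}, by simp, fun x hx => ⟨0, by simp, by simpa using hx⟩⟩
  | succ j ih =>
    obtain ⟨s, hs, hs'⟩ := ih
    obtain ⟨t, ht, -, ht'⟩ := exists_half_net F
    refine ⟨Finset.image₂ (fun c d => c + ((1 / 2 : ℝ) ^ j) • d) s t, ?_, fun x hx => ?_⟩
    · refine (Finset.card_image₂_le _ _ _).trans ((Nat.mul_le_mul hs ht).trans_eq ?_)
      rw [← pow_add, Nat.succ_mul]
    · obtain ⟨c, hc, hxc⟩ := hs' x hx
      have h0 : (0 : ℝ) < (1 / 2) ^ j := by positivity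
      obtain ⟨d, hd, hxd⟩ := ht' (((1 / 2 : ℝ) ^ j)⁻¹ • (x - c)) (by
        rw [norm_smul, norm_inv, Real.norm_of_nonneg h0.le, inv_mul_le_iff₀ h0, mul_one]
        exact hxc)
      refine ⟨_, Finset.mem_image₂_of_mem hc hd, ?_⟩
      have : x - (c + ((1 / 2 : ℝ) ^ j) • d) =
          ((1 / 2 : ℝ) ^ j) • ((((1 / 2 : ℝ) ^ j)⁻¹ • (x - c)) - d) := by
        rw [smul_sub, smul_smul, mul_inv_cancel₀ h0.ne', one_smul, sub_add_eq_sub_sub]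
      rw [this, norm_smul, Real.norm_of_nonneg h0.le, pow_succ]
      exact mul_le_mul_of_nonneg_left hxd h0.le

/-- Each useful centre of a dyadic net is replaced by a unit vector near it; the triangle inequality
doubles the mesh. The small-ball estimate needs centres of norm exactly one. -/
theorem exists_sphere_net (F : Type*) [NormedAddCommGroup F] [NormedSpace ℝ F]
    [FiniteDimensional ℝ F] (j : ℕ) :
    ∃ s : Finset F, s.card ≤ 5 ^ (j * Module.finrank ℝ F) ∧ (∀ c ∈ s, ‖c‖ = 1) ∧
      ∀ x : F, ‖x‖ = 1 → ∃ c ∈ s, ‖x - c‖ ≤ 2 * (1 / 2) ^ j := by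
  classical
  obtain ⟨s, hs, hs'⟩ := exists_dyadic_net F j
  let good : F → Prop := fun c => ∃ y : F, ‖y‖ = 1 ∧ ‖y - c‖ ≤ (1 / 2) ^ j
  let pick : F → F := fun c => if h : good c then h.choose else c
  refine ⟨(s.filter good).image pick, ?_, ?_, fun x hx => ?_⟩
  · exact Finset.card_image_le.trans ((Finset.card_filter_le _ _).trans hs)
  · simp only [Finset.mem_image, Finset.mem_filter]
    rintro _ ⟨c, ⟨-, hc⟩, rfl⟩
    simp only [pick, dif_pos hc]
    exact hc.choose_spec.1
  · obtain ⟨c, hc, hxc⟩ := hs' x hx.le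
    have hg : good c := ⟨x, hx, hxc⟩
    refine ⟨pick c, Finset.mem_image_of_mem _ (Finset.mem_filter.2 ⟨hc, hg⟩), ?_⟩
    have h1 : ‖pick c - c‖ ≤ (1 / 2) ^ j := by
      simp only [pick, dif_pos hg]
      exact hg.choose_spec.2
    calc ‖x - pick c‖ = ‖(x - c) - (pick c - c)‖ := by congr 1; abel
      _ ≤ ‖x - c‖ + ‖pick c - c‖ := norm_sub_le _ _
      _ ≤ _ := by linarith

theorem norm_le_of_half_net {F : Type*} [NormedAddCommGroup F] [InnerProductSpace ℝ F]
    {s : Finset F} (hs : ∀ x : F, ‖x‖ ≤ 1 → ∃ c ∈ s, ‖x - c‖ ≤ 1 / 2)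
    {z : F} {t : ℝ} (h : ∀ c ∈ s, inner ℝ c z ≤ t) : ‖z‖ ≤ 2 * t := by
  by_cases hz : z = 0
  · subst hz
    obtain ⟨c, hc, -⟩ := hs 0 (by simp)
    have := h c hc
    rw [inner_zero_right] at this
    simpa using this
  have hz0 : 0 < ‖z‖ := norm_pos_iff.2 hz
  obtain ⟨c, hc, hxc⟩ := hs (‖z‖⁻¹ • z) (by exact (norm_smul_inv_norm (𝕜 := ℝ) hz).le)
  have h1 : inner ℝ (‖z‖⁻¹ • z) z = ‖z‖ := by
    rw [real_inner_smul_left, real_inner_self_eq_norm_sq]; field_simp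
  have h2 : inner ℝ (‖z‖⁻¹ • z - c) z ≤ 1 / 2 * ‖z‖ :=
    (real_inner_le_norm _ _).trans (mul_le_mul_of_nonneg_right hxc hz0.le)
  rw [inner_sub_left, h1] at h2
  linarith [h c hc]

theorem norm_apply_le_of_half_nets {F : Type*} [NormedAddCommGroup F] [InnerProductSpace ℝ F]
    [FiniteDimensional ℝ F] {G : Type*} [NormedAddCommGroup G] [InnerProductSpace ℝ G]
    {s : Finset F} {t : Finset G}
    (hs : ∀ x : F, ‖x‖ ≤ 1 → ∃ c ∈ s, ‖x - c‖ ≤ 1 / 2)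
    (ht : ∀ x : G, ‖x‖ ≤ 1 → ∃ c ∈ t, ‖x - c‖ ≤ 1 / 2)
    (A : F →ₗ[ℝ] G) {a : ℝ} (ha : 0 ≤ a) (h : ∀ c ∈ s, ∀ d ∈ t, inner ℝ d (A c) ≤ a) (x : F) :
    ‖A x‖ ≤ 4 * a * ‖x‖ := by
  set A' := LinearMap.toContinuousLinearMap A with hA'
  have h1 : ∀ c ∈ s, ‖A' c‖ ≤ 2 * a := fun c hc => norm_le_of_half_net ht (h c hc)
  -- The operator norm reappears on the right with coefficient $1/2$ and is absorbed.
  have h2 : ‖A'‖ ≤ 2 * a + ‖A'‖ / 2 := by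
    refine A'.opNorm_le_of_unit_norm (by positivity) fun x hx => ?_
    obtain ⟨c, hc, hxc⟩ := hs x hx.le
    calc ‖A' x‖ = ‖A' c + A' (x - c)‖ := by rw [← map_add]; congr 2; abel
      _ ≤ ‖A' c‖ + ‖A' (x - c)‖ := norm_add_le _ _
      _ ≤ 2 * a + ‖A'‖ * (1 / 2) :=
        add_le_add (h1 c hc) ((A'.le_opNorm _).trans
          (mul_le_mul_of_nonneg_left hxc (norm_nonneg _)))
      _ = _ := by ring
  exact (A'.le_opNorm x).trans (mul_le_mul_of_nonneg_right (by linarith) (norm_nonneg _))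

theorem le_norm_apply_of_sphere_net {F : Type*} [NormedAddCommGroup F] [InnerProductSpace ℝ F]
    {G : Type*} [NormedAddCommGroup G] [InnerProductSpace ℝ G] {s : Finset F} {ε a b : ℝ}
    (hs : ∀ x : F, ‖x‖ = 1 → ∃ c ∈ s, ‖x - c‖ ≤ ε)
    (A : F →ₗ[ℝ] G) (hb0 : 0 ≤ b) (hb : ∀ x, ‖A x‖ ≤ b * ‖x‖) (ha : ∀ c ∈ s, a ≤ ‖A c‖) (x : F) :
    (a - b * ε) * ‖x‖ ≤ ‖A x‖ := by
  by_cases hx : x = 0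
  · simp [hx]
  have hx0 : 0 < ‖x‖ := norm_pos_iff.2 hx
  obtain ⟨c, hc, hxc⟩ := hs (‖x‖⁻¹ • x) (norm_smul_inv_norm (𝕜 := ℝ) hx)
  have h1 : ‖A (‖x‖⁻¹ • x)‖ = ‖x‖⁻¹ * ‖A x‖ := by
    rw [map_smul, norm_smul, norm_inv, norm_norm]
  have h2 : ‖A c‖ ≤ ‖A (‖x‖⁻¹ • x)‖ + ‖A (‖x‖⁻¹ • x - c)‖ := by
    rw [map_sub]
    calc ‖A c‖ = ‖A (‖x‖⁻¹ • x) - (A (‖x‖⁻¹ • x) - A c)‖ := by congr 1; abel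
      _ ≤ _ := norm_sub_le _ _
  have h3 : ‖A (‖x‖⁻¹ • x - c)‖ ≤ b * ε := (hb _).trans (mul_le_mul_of_nonneg_left hxc hb0)
  have h4 : a - b * ε ≤ ‖x‖⁻¹ * ‖A x‖ := by
    rw [← h1]; linarith [ha c hc]
  calc (a - b * ε) * ‖x‖ ≤ ‖x‖⁻¹ * ‖A x‖ * ‖x‖ := mul_le_mul_of_nonneg_right h4 hx0.le
    _ = ‖A x‖ := by field_simp

/-! ### The moment generating function of a sub-Gaussian variable -/

/-- Layer-cake formula for $2(\cosh(tx)-1)$, whose derivative on $x>0$ is nonnegative. Since the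
function vanishes at $0$, a comparison of tails costs the factor $e$ only on $e^{c^2t^2/2}-1$, so
the resulting bound on the generating function still tends to $1$ as $t\to0$. -/
theorem lintegral_cosh_sub_one_eq {Ω : Type*} [MeasurableSpace Ω] (P : Measure Ω)
    {η : Ω → ℝ} (hη : Measurable η) (t : ℝ) :
    ∫⁻ ω, ENNReal.ofReal (2 * (Real.cosh (t * η ω) - 1)) ∂P =
      ∫⁻ x in Set.Ioi 0, P {ω | x < |η ω|} * ENNReal.ofReal (2 * |t| * Real.sinh (|t| * x)) := by
  rw [← lintegral_comp_eq_lintegral_meas_lt_mul P (f := fun ω => |η ω|)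
    (ae_of_all _ fun ω => abs_nonneg _) hη.abs.aemeasurable
    (fun x _ => (by fun_prop : Continuous fun x => 2 * |t| * Real.sinh (|t| * x)).intervalIntegrable
      _ _)]
  · refine lintegral_congr fun ω => ?_
    congr 1
    have hderiv : ∀ x : ℝ, HasDerivAt (fun x => 2 * Real.cosh (|t| * x))
        (2 * |t| * Real.sinh (|t| * x)) x := by
      intro x
      have h1 : HasDerivAt (fun x => |t| * x) |t| x := by
        simpa using (hasDerivAt_id x).const_mul |t|
      exact (h1.cosh.const_mul 2).congr_deriv (by ring)
    rw [intervalIntegral.integral_eq_sub_of_hasDerivAt (fun x _ => hderiv x)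
      ((by fun_prop : Continuous fun x => 2 * |t| * Real.sinh (|t| * x)).intervalIntegrable _ _)]
    rw [← abs_mul, Real.cosh_abs]
    simp
    ring
  · filter_upwards [self_mem_ae_restrict measurableSet_Ioi] with x hx
    have : 0 ≤ Real.sinh (|t| * x) :=
      Real.sinh_nonneg_iff.2 (mul_nonneg (abs_nonneg _) (le_of_lt hx))
    positivity

theorem lintegral_cosh_sub_one_le {Ω : Type*} [MeasurableSpace Ω] {P : Measure Ω}
    {η : Ω → ℝ} (hη : Measurable η) {c : ℝ} (h : IsSubGaussianVar P η c) (t : ℝ) :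
    ∫⁻ ω, ENNReal.ofReal (2 * (Real.cosh (t * η ω) - 1)) ∂P ≤
      ENNReal.ofReal (2 * Real.exp 1 * (Real.exp (c ^ 2 * t ^ 2 / 2) - 1)) := by
  have hgauss : ∫⁻ z, ENNReal.ofReal (2 * (Real.cosh (t * z) - 1))
      ∂(gaussianReal 0 (Real.toNNReal (c ^ 2))) =
      ENNReal.ofReal (2 * (Real.exp (c ^ 2 * t ^ 2 / 2) - 1)) := by
    have hint : ∀ s : ℝ, Integrable (fun z => Real.exp (s * z))
        (gaussianReal 0 (Real.toNNReal (c ^ 2))) := fun s => integrable_exp_mul_gaussianReal s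
    have hval : ∀ s : ℝ, ∫ z, Real.exp (s * z) ∂(gaussianReal 0 (Real.toNNReal (c ^ 2))) =
        Real.exp (c ^ 2 * s ^ 2 / 2) := by
      intro s
      have := mgf_gaussianReal (p := gaussianReal 0 (Real.toNNReal (c ^ 2))) (X := id)
        (μ := 0) (v := Real.toNNReal (c ^ 2)) (by simp) s
      rw [mgf] at this
      simpa [Real.coe_toNNReal _ (sq_nonneg c)] using this
    have heq : (fun z => 2 * (Real.cosh (t * z) - 1)) =
        fun z => Real.exp (t * z) + Real.exp (-t * z) - 2 := by
      funext z
      rw [Real.cosh_eq, neg_mul]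
      ring
    have hadd : Integrable (fun z => Real.exp (t * z) + Real.exp (-t * z))
        (gaussianReal 0 (Real.toNNReal (c ^ 2))) := (hint t).add (hint (-t))
    rw [← ofReal_integral_eq_lintegral_ofReal, heq, integral_sub hadd (integrable_const _), integral_add (hint t) (hint (-t)), hval, hval]
    · congr 1
      simp
      ring
    · rw [heq]
      exact hadd.sub (integrable_const _)
    · exact ae_of_all _ fun z => mul_nonneg zero_le_two (sub_nonneg.2 (Real.one_le_cosh _))
  have hexp : (2 * Real.exp 1 * (Real.exp (c ^ 2 * t ^ 2 / 2) - 1)) =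
      Real.exp 1 * (2 * (Real.exp (c ^ 2 * t ^ 2 / 2) - 1)) := by ring
  rw [hexp, ENNReal.ofReal_mul (Real.exp_pos _).le, ← hgauss, lintegral_cosh_sub_one_eq P hη,
    lintegral_cosh_sub_one_eq _ (η := fun z => z) measurable_id, ← lintegral_const_mul']
  · refine setLIntegral_mono' measurableSet_Ioi fun x hx => ?_
    rw [← mul_assoc]
    exact mul_le_mul_left (h x (le_of_lt hx)) _
  · exact ENNReal.ofReal_ne_top

/-- Bernoulli's inequality for $(e^y)^a$; it moves the factor $2e$ into the variance proxy. -/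
theorem one_add_mul_exp_sub_one_le {a y : ℝ} (ha : 1 ≤ a) :
    1 + a * (Real.exp y - 1) ≤ Real.exp (a * y) := by
  have h := one_add_mul_self_le_rpow_one_add (s := Real.exp y - 1)
    (by linarith [Real.exp_pos y]) ha
  rwa [add_sub_cancel, ← Real.exp_mul, mul_comm y a] at h

/-- A centred sub-Gaussian variable with parameter `c` has a sub-Gaussian moment generating
function, with variance proxy `2ec²`. -/
theorem IsSubGaussianVar.hasSubgaussianMGF {Ω : Type*} [MeasurableSpace Ω] {P : Measure Ω}
    [IsProbabilityMeasure P] {η : Ω → ℝ} (hη : Measurable η) {c : ℝ}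
    (h : IsSubGaussianVar P η c) (hmean : ∫ ω, η ω ∂P = 0) :
    HasSubgaussianMGF η (Real.toNNReal (2 * Real.exp 1 * c ^ 2)) P := by
  have hcosh : ∀ t : ℝ, Integrable (fun ω => 2 * (Real.cosh (t * η ω) - 1)) P := by
    intro t
    refine ⟨by fun_prop, ?_⟩
    rw [hasFiniteIntegral_iff_ofReal
      (ae_of_all _ fun ω => mul_nonneg zero_le_two (sub_nonneg.2 (Real.one_le_cosh _)))]
    exact (lintegral_cosh_sub_one_le hη h t).trans_lt ENNReal.ofReal_lt_top
  have hint : ∀ t : ℝ, Integrable (fun ω => Real.exp (t * η ω)) P := by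
    intro t
    refine ((hcosh t).add (integrable_const 2)).mono' (by fun_prop) (ae_of_all _ fun ω => ?_)
    rw [Real.norm_of_nonneg (Real.exp_pos _).le]
    simp only [Pi.add_apply, Real.cosh_eq]
    linarith [Real.exp_pos (-(t * η ω))]
  have hηint : Integrable η P := by
    refine ((hint 1).add (hint (-1))).mono' hη.aestronglyMeasurable (ae_of_all _ fun ω => ?_)
    simp only [Pi.add_apply, Real.norm_eq_abs, one_mul, neg_mul]
    refine abs_le.2 ⟨?_, ?_⟩
    · linarith [Real.add_one_le_exp (-η ω), Real.exp_pos (η ω)]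
    · linarith [Real.add_one_le_exp (η ω), Real.exp_pos (-η ω)]
  refine ⟨hint, fun t => ?_⟩
  have h1 : ∫ ω, 2 * (Real.cosh (t * η ω) - 1) ∂P ≤
      2 * Real.exp 1 * (Real.exp (c ^ 2 * t ^ 2 / 2) - 1) := by
    have hpos : 0 ≤ 2 * Real.exp 1 * (Real.exp (c ^ 2 * t ^ 2 / 2) - 1) :=
      mul_nonneg (by positivity) (sub_nonneg.2 (Real.one_le_exp (by positivity)))
    rw [integral_eq_lintegral_of_nonneg_ae
      (ae_of_all _ fun ω => mul_nonneg zero_le_two (sub_nonneg.2 (Real.one_le_cosh _)))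
      (by fun_prop)]
    exact ENNReal.toReal_le_of_le_ofReal hpos (lintegral_cosh_sub_one_le hη h t)
  -- From $e^x\le1+x+2(\cosh x-1)$, which is $1-x\le e^{-x}$; the linear term disappears because the
  -- mean is zero.
  have h2 : mgf η P t ≤ 1 + ∫ ω, 2 * (Real.cosh (t * η ω) - 1) ∂P := by
    have hlin : Integrable (fun ω => 1 + t * η ω) P :=
      (integrable_const _).add (hηint.const_mul t)
    have h3 : ∫ ω, (1 + t * η ω + 2 * (Real.cosh (t * η ω) - 1)) ∂P =
        1 + ∫ ω, 2 * (Real.cosh (t * η ω) - 1) ∂P := by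
      rw [integral_add hlin (hcosh t),
        integral_add (integrable_const _) (hηint.const_mul t), integral_const_mul, hmean]
      simp
    rw [← h3, mgf]
    refine integral_mono (hint t) (hlin.add (hcosh t)) fun ω => ?_
    simp only [Real.cosh_eq]
    linarith [Real.add_one_le_exp (-(t * η ω))]
  have he : (1 : ℝ) ≤ 2 * Real.exp 1 := by linarith [Real.add_one_le_exp (1 : ℝ)]
  have h4 := one_add_mul_exp_sub_one_le (y := c ^ 2 * t ^ 2 / 2) he
  rw [Real.coe_toNNReal _ (by positivity)]
  calc mgf η P t ≤ Real.exp (2 * Real.exp 1 * (c ^ 2 * t ^ 2 / 2)) := by linarith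
    _ = _ := by congr 1; ring

/-! ### Lower tail of the norm of a random combination of a Parseval frame -/

theorem integral_pow_four_le {Ω : Type*} [MeasurableSpace Ω] {P : Measure Ω}
    [IsProbabilityMeasure P] {X : Ω → ℝ} {κ : NNReal} (hX : HasSubgaussianMGF X κ P) :
    Integrable (fun ω => X ω ^ 4) P ∧ ∫ ω, X ω ^ 4 ∂P ≤ 48 * Real.exp (κ / 2) := by
  have hpt : ∀ x : ℝ, x ^ 4 ≤ 24 * (Real.exp (1 * x) + Real.exp (-1 * x)) := by
    intro x
    have h1 := Real.pow_div_factorial_le_exp |x| (abs_nonneg x) 4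
    have h2 : Real.exp |x| ≤ Real.exp (1 * x) + Real.exp (-1 * x) := by
      rcases abs_cases x with ⟨h, -⟩ | ⟨h, -⟩ <;> rw [h]
      · rw [one_mul]; linarith [Real.exp_pos (-1 * x)]
      · rw [neg_one_mul]; linarith [Real.exp_pos (1 * x)]
    have h3 : |x| ^ 4 = x ^ 4 := by
      rw [show (4 : ℕ) = 2 * 2 from rfl, pow_mul, sq_abs, pow_mul]
    have h4 : ((Nat.factorial 4 : ℕ) : ℝ) = 24 := by norm_num [Nat.factorial]
    rw [h3, h4] at h1
    linarith
  have hint : Integrable (fun ω => 24 * (Real.exp (1 * X ω) + Real.exp (-1 * X ω))) P :=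
    ((hX.integrable_exp_mul 1).add (hX.integrable_exp_mul (-1))).const_mul 24
  have h4 : Integrable (fun ω => X ω ^ 4) P := by
    refine hint.mono' (hX.aestronglyMeasurable.pow 4) (ae_of_all _ fun ω => ?_)
    rw [Real.norm_of_nonneg (by positivity)]
    exact hpt _
  refine ⟨h4, (integral_mono h4 hint fun ω => hpt (X ω)).trans ?_⟩
  rw [integral_const_mul, integral_add (hX.integrable_exp_mul 1) (hX.integrable_exp_mul (-1))]
  have h1 := hX.mgf_le 1
  have h2 := hX.mgf_le (-1)
  rw [mgf] at h1 h2
  norm_num at h1 h2 ⊢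
  linarith

/-- Second-order expansion $e^{-y}\le1-y+y^2/2$ at $y=2qX^2$: the fourth-moment term is at most $q$
because $q$ is small, leaving $1-q$. -/
theorem integral_exp_neg_mul_sq_le {Ω : Type*} [MeasurableSpace Ω] {P : Measure Ω}
    [IsProbabilityMeasure P] {X : Ω → ℝ} {κ : NNReal} (hX : HasSubgaussianMGF X κ P)
    (hvar : ∫ ω, X ω ^ 2 ∂P = 1) {q : ℝ} (hq : 0 ≤ q) (hq' : q * (48 * Real.exp (κ / 2)) ≤ 1 / 2) :
    Integrable (fun ω => Real.exp (-(2 * q * X ω ^ 2))) P ∧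
      ∫ ω, Real.exp (-(2 * q * X ω ^ 2)) ∂P ≤ Real.exp (-q) := by
  obtain ⟨h4, h4'⟩ := integral_pow_four_le hX
  have h2 : Integrable (fun ω => X ω ^ 2) P := by
    have := hX.memLp 2
    exact (memLp_two_iff_integrable_sq hX.aestronglyMeasurable).1 (by simpa using this)
  have hpt : ∀ y : ℝ, 0 ≤ y → Real.exp (-y) ≤ 1 - y + y ^ 2 / 2 := by
    intro y hy
    have h1 := Real.quadratic_le_exp_of_nonneg hy
    have h2 : 0 < 1 - y + y ^ 2 / 2 := by nlinarith [sq_nonneg (y - 1)]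
    rw [Real.exp_neg, inv_le_iff_one_le_mul₀ (Real.exp_pos y)]
    -- The product equals $1+y^4/4$.
    have h3 : 1 ≤ (1 - y + y ^ 2 / 2) * (1 + y + y ^ 2 / 2) := by nlinarith [sq_nonneg (y ^ 2)]
    exact h3.trans (mul_le_mul_of_nonneg_left h1 h2.le)
  have hI : Integrable (fun ω => Real.exp (-(2 * q * X ω ^ 2))) P := by
    refine (integrable_const (1 : ℝ)).mono' ?_ (ae_of_all _ fun ω => ?_)
    · exact Real.continuous_exp.comp_aestronglyMeasurable
        ((hX.aestronglyMeasurable.pow 2).const_mul (2 * q)).neg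
    · rw [Real.norm_of_nonneg (Real.exp_pos _).le, Real.exp_le_one_iff]
      have : 0 ≤ 2 * q * X ω ^ 2 := by positivity
      linarith
  refine ⟨hI, ?_⟩
  have hI2 : Integrable (fun ω => 1 - 2 * q * X ω ^ 2) P :=
    (integrable_const _).sub (h2.const_mul _)
  calc ∫ ω, Real.exp (-(2 * q * X ω ^ 2)) ∂P
      ≤ ∫ ω, (1 - 2 * q * X ω ^ 2 + 2 * q ^ 2 * X ω ^ 4) ∂P := by
        refine integral_mono hI (hI2.add (h4.const_mul _)) fun ω => ?_
        have := hpt (2 * q * X ω ^ 2) (by positivity)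
        refine this.trans_eq ?_
        ring
    _ = 1 - 2 * q + 2 * q ^ 2 * ∫ ω, X ω ^ 4 ∂P := by
        rw [integral_add hI2 (h4.const_mul _), integral_sub (integrable_const _) (h2.const_mul _),
          integral_const_mul, integral_const_mul, hvar]
        simp
    _ ≤ 1 - q := by
        have h5 : q * ∫ ω, X ω ^ 4 ∂P ≤ 1 / 2 := (mul_le_mul_of_nonneg_left h4' hq).trans hq'
        nlinarith
    _ ≤ Real.exp (-q) := by linarith [Real.add_one_le_exp (-q)]

/-- The Cauchy–Schwarz inequality separates $e^{-2bX}$, controlled by the sub-Gaussian bound, from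
$e^{-qX^2}$, controlled by the unit variance. The shift $b$ carries the influence of the other
coordinates. -/
theorem lintegral_exp_quadratic_le {Ω : Type*} [MeasurableSpace Ω] {P : Measure Ω}
    [IsProbabilityMeasure P] {X : Ω → ℝ} {κ : NNReal} (hX : HasSubgaussianMGF X κ P)
    (hvar : ∫ ω, X ω ^ 2 ∂P = 1) {q : ℝ} (hq : 0 ≤ q) (hq' : q * (48 * Real.exp (κ / 2)) ≤ 1 / 2)
    (b : ℝ) :
    ∫⁻ ω, ENNReal.ofReal (Real.exp (-(2 * X ω * b + q * X ω ^ 2))) ∂P ≤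
      ENNReal.ofReal (Real.exp (4 * κ * b ^ 2 - q / 2)) := by
  obtain ⟨hI, hI'⟩ := integral_exp_neg_mul_sq_le hX hvar hq hq'
  have hJ := hX.integrable_exp_mul (-4 * b)
  have hJ' := hX.mgf_le (-4 * b)
  rw [mgf] at hJ'
  -- The weights $c_1,c_2$ satisfy $4c_1c_2=1$, as the arithmetic–geometric mean inequality
  -- requires, and make each of the two terms half of the final bound.
  set c₁ := Real.exp (-q / 2 - 4 * κ * b ^ 2) / 2 with hc₁
  set c₂ := Real.exp (4 * κ * b ^ 2 + q / 2) / 2 with hc₂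
  have hc₁0 : 0 < c₁ := by positivity
  have hc₂0 : 0 < c₂ := by positivity
  have hpt : ∀ x : ℝ, Real.exp (-(2 * x * b + q * x ^ 2)) ≤
      c₁ * Real.exp (-4 * b * x) + c₂ * Real.exp (-(2 * q * x ^ 2)) := by
    intro x
    have h1 : c₁ * Real.exp (-4 * b * x) =
        Real.exp ((-q / 2 - 4 * κ * b ^ 2) / 2 - 2 * b * x) ^ 2 / 2 := by
      rw [hc₁, ← Real.exp_nat_mul, div_mul_eq_mul_div, ← Real.exp_add]
      congr 2; push_cast; ring
    have h2 : c₂ * Real.exp (-(2 * q * x ^ 2)) =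
        Real.exp ((4 * κ * b ^ 2 + q / 2) / 2 - q * x ^ 2) ^ 2 / 2 := by
      rw [hc₂, ← Real.exp_nat_mul, div_mul_eq_mul_div, ← Real.exp_add]
      congr 2; push_cast; ring
    have h3 : Real.exp (-(2 * x * b + q * x ^ 2)) =
        Real.exp ((-q / 2 - 4 * κ * b ^ 2) / 2 - 2 * b * x) *
          Real.exp ((4 * κ * b ^ 2 + q / 2) / 2 - q * x ^ 2) := by
      rw [← Real.exp_add]
      congr 1; ring
    rw [h1, h2, h3]
    nlinarith [sq_nonneg (Real.exp ((-q / 2 - 4 * κ * b ^ 2) / 2 - 2 * b * x) -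
      Real.exp ((4 * κ * b ^ 2 + q / 2) / 2 - q * x ^ 2))]
  have hint : Integrable (fun ω => c₁ * Real.exp (-4 * b * X ω) +
      c₂ * Real.exp (-(2 * q * X ω ^ 2))) P := (hJ.const_mul _).add (hI.const_mul _)
  calc ∫⁻ ω, ENNReal.ofReal (Real.exp (-(2 * X ω * b + q * X ω ^ 2))) ∂P
      ≤ ∫⁻ ω, ENNReal.ofReal (c₁ * Real.exp (-4 * b * X ω) +
          c₂ * Real.exp (-(2 * q * X ω ^ 2))) ∂P :=
        lintegral_mono fun ω => ENNReal.ofReal_le_ofReal (hpt _)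
    _ = ENNReal.ofReal (∫ ω, (c₁ * Real.exp (-4 * b * X ω) +
          c₂ * Real.exp (-(2 * q * X ω ^ 2))) ∂P) := by
        rw [ofReal_integral_eq_lintegral_ofReal hint]
        exact ae_of_all _ fun ω => by positivity
    _ ≤ _ := by
        refine ENNReal.ofReal_le_ofReal ?_
        rw [integral_add (hJ.const_mul _) (hI.const_mul _), integral_const_mul,
          integral_const_mul]
        have h1 : c₁ * Real.exp (κ * (-4 * b) ^ 2 / 2) = Real.exp (4 * κ * b ^ 2 - q / 2) / 2 := by
          rw [hc₁, div_mul_eq_mul_div, ← Real.exp_add]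
          congr 2; ring
        have h2 : c₂ * Real.exp (-q) = Real.exp (4 * κ * b ^ 2 - q / 2) / 2 := by
          rw [hc₂, div_mul_eq_mul_div, ← Real.exp_add]
          congr 2; ring
        have h3 := mul_le_mul_of_nonneg_left hJ' hc₁0.le
        have h4 := mul_le_mul_of_nonneg_left hI' hc₂0.le
        linarith

theorem lintegral_indepFun {Ω α β : Type*} [MeasurableSpace Ω] [MeasurableSpace α]
    [MeasurableSpace β] {P : Measure Ω} [IsProbabilityMeasure P] {X : Ω → α} {Y : Ω → β}
    (hX : Measurable X) (hY : Measurable Y) (h : IndepFun X Y P) {f : α → β → ENNReal}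
    (hf : Measurable (Function.uncurry f)) :
    ∫⁻ ω, f (X ω) (Y ω) ∂P = ∫⁻ ω, ∫⁻ ω', f (X ω) (Y ω') ∂P ∂P := by
  have h1 := (indepFun_iff_map_prod_eq_prod_map_map hX.aemeasurable hY.aemeasurable).1 h
  have : IsProbabilityMeasure (P.map X) := Measure.isProbabilityMeasure_map hX.aemeasurable
  have : IsProbabilityMeasure (P.map Y) := Measure.isProbabilityMeasure_map hY.aemeasurable
  calc ∫⁻ ω, f (X ω) (Y ω) ∂P = ∫⁻ z, Function.uncurry f z ∂(P.map fun ω => (X ω, Y ω)) := by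
        rw [lintegral_map hf (hX.prodMk hY)]; rfl
    _ = ∫⁻ x, ∫⁻ y, f x y ∂(P.map Y) ∂(P.map X) := by
        rw [h1, lintegral_prod _ hf.aemeasurable]; rfl
    _ = ∫⁻ ω, ∫⁻ y, f (X ω) y ∂(P.map Y) ∂P := by
        exact lintegral_map hf.lintegral_prod_right' hX
    _ = _ := by
        refine lintegral_congr fun ω => ?_
        exact lintegral_map (hf.comp measurable_prodMk_left) hY

/-- One-coordinate-at-a-time estimate of the Laplace transform of a quadratic form. -/
theorem lintegral_exp_neg_quadraticForm_le {Ω ι : Type*} [MeasurableSpace Ω] {P : Measure Ω}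
    [IsProbabilityMeasure P] {n : ℕ} {η : ι → Ω → ℝ} {κ : NNReal} {s : ℝ}
    (hmeas : ∀ i, Measurable (η i))
    (hind : ∀ (T : Finset ι) (j : ι), j ∉ T → IndepFun (fun ω (i : T) => η i ω) (η j) P)
    (hsub : ∀ i, HasSubgaussianMGF (η i) κ P) (hvar : ∀ i, ∫ ω, η i ω ^ 2 ∂P = 1)
    (hs : 0 < s) (hs1 : 4 * κ * s ≤ 1 / 2) (hs2 : s * (48 * Real.exp (κ / 2)) ≤ 1 / 2)
    (p : ι → EuclideanSpace ℝ (Fin n)) (T : Finset ι) (ρ : EuclideanSpace ℝ (Fin n) → ℝ)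
    (hρ0 : ∀ y, 0 ≤ ρ y) (hρ : ∀ y, ρ y + ∑ i ∈ T, (inner ℝ (p i) y) ^ 2 ≤ ‖y‖ ^ 2)
    (M : EuclideanSpace ℝ (Fin n) →L[ℝ] EuclideanSpace ℝ (Fin n))
    (hsymm : ∀ x y, inner ℝ (M x) y = inner ℝ x (M y))
    (hub : ∀ a, inner ℝ (M a) a ≤ s * ‖a‖ ^ 2)
    (hinv : ∀ a y, 2 * inner ℝ a y - ‖y‖ ^ 2 / s - 8 * κ * ρ y ≤ inner ℝ (M a) a) :
    ∫⁻ ω, ENNReal.ofReal (Real.exp (-inner ℝ (M (∑ i ∈ T, η i ω • p i))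
      (∑ i ∈ T, η i ω • p i))) ∂P ≤ ENNReal.ofReal (Real.exp (-(s / 4 * ∑ i ∈ T, ‖p i‖ ^ 2))) := by
  classical
  -- For a quadratic form $\rho$, `hinv` says $M\ge(1/s+8\kappa\rho)^{-1}$ in variational form, with
  -- no operator inverted. Here $\rho$ collects the terms $\langle p_i,y\rangle^2$ of the
  -- coordinates already integrated out, and `hρ` keeps it below the identity, so $M\ge s/2$
  -- throughout.
  induction T using Finset.induction_on generalizing ρ M with
  | empty => simp
  | insert j T hj ih =>
    have hκ : (0 : ℝ) ≤ κ := κ.2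
    set q := inner ℝ (M (p j)) (p j) with hq
    have hpj : ‖p j‖ ^ 2 ≤ 1 := by
      have h1 := hρ (p j)
      rw [Finset.sum_insert hj, real_inner_self_eq_norm_sq] at h1
      have h2 : 0 ≤ ∑ i ∈ T, (inner ℝ (p i) (p j)) ^ 2 := Finset.sum_nonneg fun _ _ => sq_nonneg _
      have h3 := hρ0 (p j)
      by_contra! hcon
      nlinarith
    have hqub : q ≤ s * ‖p j‖ ^ 2 := hub _
    have hqs : q ≤ s := hqub.trans (by nlinarith)
    have hqlb : s / 2 * ‖p j‖ ^ 2 ≤ q := by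
      -- The maximizing $y$ in the worst case $1/s+8\kappa\rho=2/s$; the value is $\frac
      -- s2\|p_j\|^2$.
      have h1 := hinv (p j) ((s / 2) • p j)
      have h2 : ρ ((s / 2) • p j) ≤ s ^ 2 / 4 * ‖p j‖ ^ 2 := by
        have h3 := hρ ((s / 2) • p j)
        have h4 : 0 ≤ ∑ i ∈ insert j T, (inner ℝ (p i) ((s / 2) • p j)) ^ 2 :=
          Finset.sum_nonneg fun _ _ => sq_nonneg _
        rw [norm_smul, mul_pow, Real.norm_eq_abs, sq_abs] at h3
        linarith
      rw [real_inner_smul_right, real_inner_self_eq_norm_sq, norm_smul, mul_pow, Real.norm_eq_abs,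
        sq_abs] at h1
      have h5 : (s / 2) ^ 2 * ‖p j‖ ^ 2 / s = s / 4 * ‖p j‖ ^ 2 := by field_simp; ring
      rw [h5] at h1
      have h6 : 8 * κ * ρ ((s / 2) • p j) ≤ 8 * κ * (s ^ 2 / 4 * ‖p j‖ ^ 2) :=
        mul_le_mul_of_nonneg_left h2 (by positivity)
      have h7 : 8 * κ * (s ^ 2 / 4 * ‖p j‖ ^ 2) ≤ s / 4 * ‖p j‖ ^ 2 := by
        have h8 : 0 ≤ s * ‖p j‖ ^ 2 := by positivity
        nlinarith
      linarith
    have hq0 : 0 ≤ q := le_trans (by positivity) hqlb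
    have hCq : 4 * κ * q ≤ 1 / 2 := le_trans (by gcongr) hs1
    -- Integrating $\eta_j$ costs $\exp(4\kappa\langle Mx,p_j\rangle^2)$, a rank-one decrease of the
    -- form, and gains $e^{-q/2}\le e^{-s\|p_j\|^2/4}$.
    set M' : EuclideanSpace ℝ (Fin n) →L[ℝ] EuclideanSpace ℝ (Fin n) :=
      M - (4 * κ : ℝ) • (innerSL ℝ (M (p j))).smulRight (M (p j)) with hM'
    have hM'q : ∀ a, inner ℝ (M' a) a = inner ℝ (M a) a - 4 * κ * (inner ℝ (M a) (p j)) ^ 2 := by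
      intro a
      have h1 : inner ℝ (M (p j)) a = inner ℝ (M a) (p j) := by
        rw [hsymm, real_inner_comm]
      simp only [hM', _root_.sub_apply, _root_.smul_apply,
        ContinuousLinearMap.smulRight_apply, innerSL_apply_apply, inner_sub_left,
        real_inner_smul_left, h1]
      ring
    have hih := ih (fun y => ρ y + (inner ℝ (p j) y) ^ 2)
      (fun y => add_nonneg (hρ0 y) (sq_nonneg _))
      (fun y => by
        have := hρ y
        rw [Finset.sum_insert hj] at this
        linarith) M'
      (fun x y => by
        simp only [hM', _root_.sub_apply, _root_.smul_apply,
          ContinuousLinearMap.smulRight_apply, innerSL_apply_apply, inner_sub_left,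
          inner_sub_right, real_inner_smul_left, real_inner_smul_right, hsymm x y]
        rw [real_inner_comm x (M (p j))]
        ring)
      (fun a => by
        rw [hM'q]
        have : 0 ≤ 4 * κ * (inner ℝ (M a) (p j)) ^ 2 := by positivity
        linarith [hub a])
      (fun a y => by
        rw [hM'q]
        set t := inner ℝ (M a) (p j) with ht
        set w := inner ℝ (p j) y with hw
        -- Sherman–Morrison in variational form: testing at $a-4\kappa tp_j$ leaves, after $4\kappa
        -- q\le1/2$, exactly the square $2\kappa(t-2w)^2$.
        have h1 := hinv (a + (-(4 * κ * t)) • p j) y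
        have h2 : inner ℝ (M (p j)) a = t := by rw [hsymm, real_inner_comm]
        rw [map_add, map_smul, inner_add_left, inner_add_left, inner_add_right, inner_add_right,
          real_inner_smul_left, real_inner_smul_left, real_inner_smul_left, real_inner_smul_right,
          real_inner_smul_right, h2, ← ht, ← hw, ← hq] at h1
        have h3 : 4 * κ * q * (4 * κ * t ^ 2) ≤ 1 / 2 * (4 * κ * t ^ 2) :=
          mul_le_mul_of_nonneg_right hCq (by positivity)
        have h4 : 0 ≤ 2 * κ * (t - 2 * w) ^ 2 := by positivity
        nlinarith)
    set X : Ω → EuclideanSpace ℝ (Fin n) := fun ω => ∑ i ∈ T, η i ω • p i with hX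
    have hXm : Measurable X :=
      Finset.measurable_sum _ fun i _ => (hmeas i).smul_const (p i)
    have hindX : IndepFun X (η j) P := by
      have h2 := (hind T j hj).comp (φ := fun u : T → ℝ => ∑ i : T, u i • p i) (ψ := id)
        (Finset.measurable_sum _ fun i _ => (measurable_pi_apply i).smul_const (p i))
        measurable_id
      have hXeq : X = (fun u : T → ℝ => ∑ i : T, u i • p i) ∘ fun ω (i : T) => η i ω := by
        funext ω
        exact (Finset.sum_coe_sort T fun i => η i ω • p i).symm
      rw [hXeq]
      exact h2
    have hfm : Measurable (Function.uncurry fun (x : EuclideanSpace ℝ (Fin n)) (z : ℝ) =>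
        ENNReal.ofReal (Real.exp (-inner ℝ (M (z • p j + x)) (z • p j + x)))) := by
      refine ENNReal.measurable_ofReal.comp (Continuous.measurable ?_)
      fun_prop
    have hstep : ∀ x : EuclideanSpace ℝ (Fin n),
        ∫⁻ ω, ENNReal.ofReal (Real.exp (-inner ℝ (M (η j ω • p j + x)) (η j ω • p j + x))) ∂P ≤
          ENNReal.ofReal (Real.exp (-(s / 4 * ‖p j‖ ^ 2))) *
            ENNReal.ofReal (Real.exp (-inner ℝ (M' x) x)) := by
      intro x
      have h1 : ∀ ω, ENNReal.ofReal (Real.exp (-inner ℝ (M (η j ω • p j + x)) (η j ω • p j + x))) =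
          ENNReal.ofReal (Real.exp (-inner ℝ (M x) x)) * ENNReal.ofReal
            (Real.exp (-(2 * η j ω * inner ℝ (M x) (p j) + q * η j ω ^ 2))) := by
        intro ω
        have h2 : inner ℝ (M (p j)) x = inner ℝ (M x) (p j) := by rw [hsymm, real_inner_comm]
        rw [← ENNReal.ofReal_mul (Real.exp_pos _).le, ← Real.exp_add]
        congr 2
        rw [map_add, map_smul, inner_add_left, inner_add_right, inner_add_right,
          real_inner_smul_left, real_inner_smul_left, real_inner_smul_right,
          real_inner_smul_right, h2, ← hq]
        ring
      simp only [h1]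
      rw [lintegral_const_mul' _ _ ENNReal.ofReal_ne_top]
      refine (mul_le_mul_right (lintegral_exp_quadratic_le (hsub j) (hvar j) hq0
        (le_trans (by gcongr) hs2) _) _).trans ?_
      rw [← ENNReal.ofReal_mul (Real.exp_pos _).le, ← ENNReal.ofReal_mul (Real.exp_pos _).le,
        ← Real.exp_add, ← Real.exp_add, hM'q]
      refine ENNReal.ofReal_le_ofReal (Real.exp_le_exp.2 ?_)
      linarith
    have hsum : ∀ ω, ∑ i ∈ insert j T, η i ω • p i = η j ω • p j + X ω := fun ω =>
      Finset.sum_insert hj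
    simp only [hsum]
    calc _ = ∫⁻ ω, ∫⁻ ω', ENNReal.ofReal (Real.exp
            (-inner ℝ (M (η j ω' • p j + X ω)) (η j ω' • p j + X ω))) ∂P ∂P :=
          lintegral_indepFun hXm (hmeas j) hindX hfm
      _ ≤ ∫⁻ ω, ENNReal.ofReal (Real.exp (-(s / 4 * ‖p j‖ ^ 2))) *
            ENNReal.ofReal (Real.exp (-inner ℝ (M' (X ω)) (X ω))) ∂P :=
          lintegral_mono fun ω => hstep (X ω)
      _ = ENNReal.ofReal (Real.exp (-(s / 4 * ‖p j‖ ^ 2))) *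
            ∫⁻ ω, ENNReal.ofReal (Real.exp (-inner ℝ (M' (X ω)) (X ω))) ∂P :=
          lintegral_const_mul' _ _ ENNReal.ofReal_ne_top
      _ ≤ _ := by
          refine (mul_le_mul_right hih _).trans_eq ?_
          rw [← ENNReal.ofReal_mul (Real.exp_pos _).le, ← Real.exp_add, Finset.sum_insert hj]
          congr 2
          ring

/-- Lower tail of `‖∑ η_i p_i‖²` for independent sub-Gaussian `η_i` of unit variance and a
Parseval frame `p` of an `n`-dimensional space. -/
theorem measure_norm_sq_sum_smul_le {Ω ι : Type*} [MeasurableSpace Ω] {P : Measure Ω}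
    [IsProbabilityMeasure P] [Fintype ι] {n : ℕ} {η : ι → Ω → ℝ} {κ : NNReal} {s : ℝ}
    (hmeas : ∀ i, Measurable (η i))
    (hind : ∀ (T : Finset ι) (j : ι), j ∉ T → IndepFun (fun ω (i : T) => η i ω) (η j) P)
    (hsub : ∀ i, HasSubgaussianMGF (η i) κ P) (hvar : ∀ i, ∫ ω, η i ω ^ 2 ∂P = 1)
    (hs : 0 < s) (hs1 : 4 * κ * s ≤ 1 / 2) (hs2 : s * (48 * Real.exp (κ / 2)) ≤ 1 / 2)
    (p : ι → EuclideanSpace ℝ (Fin n)) (hp : ∀ y, ∑ i, (inner ℝ (p i) y) ^ 2 = ‖y‖ ^ 2)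
    (hpn : ∑ i, ‖p i‖ ^ 2 = n) :
    P {ω | ‖∑ i, η i ω • p i‖ ^ 2 ≤ n / 8} ≤ ENNReal.ofReal (Real.exp (-(s / 8 * n))) := by
  -- Start from $M=s\cdot\mathrm{id}$ and $\rho=0$, where `hinv` is $\|sa-y\|^2\ge0$. The outcome
  -- $e^{-sn/4}$ and Markov's inequality at level $e^{-sn/8}$ give the claim.
  have h1 := lintegral_exp_neg_quadraticForm_le hmeas hind hsub hvar hs hs1 hs2 p Finset.univ
    (fun _ => 0) (fun _ => le_rfl) (fun y => by rw [zero_add, hp])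
    (s • ContinuousLinearMap.id ℝ _) (fun x y => by
      simp [real_inner_smul_left, real_inner_smul_right])
    (fun a => by simp [real_inner_smul_left])
    (fun a y => by
      have h2 : 0 ≤ ‖s • a - y‖ ^ 2 / s := by positivity
      rw [norm_sub_sq_real, norm_smul, mul_pow, Real.norm_eq_abs, sq_abs,
        real_inner_smul_left] at h2
      have h3 : (s ^ 2 * ‖a‖ ^ 2 - 2 * (s * inner ℝ a y) + ‖y‖ ^ 2) / s =
          s * ‖a‖ ^ 2 - 2 * inner ℝ a y + ‖y‖ ^ 2 / s := by field_simp
      rw [h3] at h2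
      simp only [_root_.smul_apply, ContinuousLinearMap.id_apply,
        real_inner_smul_left, real_inner_self_eq_norm_sq, mul_zero, sub_zero]
      linarith)
  rw [hpn] at h1
  simp only [_root_.smul_apply, ContinuousLinearMap.id_apply,
    real_inner_smul_left, real_inner_self_eq_norm_sq] at h1
  have hset : {ω | ‖∑ i, η i ω • p i‖ ^ 2 ≤ n / 8} ⊆
      {ω | ENNReal.ofReal (Real.exp (-(s / 8 * n))) ≤
        ENNReal.ofReal (Real.exp (-(s * ‖∑ i, η i ω • p i‖ ^ 2)))} := by
    intro ω hω
    refine ENNReal.ofReal_le_ofReal (Real.exp_le_exp.2 (neg_le_neg ?_))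
    have := mul_le_mul_of_nonneg_left (show ‖∑ i, η i ω • p i‖ ^ 2 ≤ n / 8 from hω) hs.le
    linarith
  refine (measure_mono hset).trans ((meas_ge_le_lintegral_div ?_ ?_ ENNReal.ofReal_ne_top).trans ?_)
  · have : Measurable fun ω => ∑ i, η i ω • p i :=
      Finset.measurable_sum _ fun i _ => (hmeas i).smul_const (p i)
    fun_prop
  · exact (ENNReal.ofReal_pos.2 (Real.exp_pos _)).ne'
  · refine (ENNReal.div_le_div_right h1 _).trans_eq ?_
    rw [← ENNReal.ofReal_div_of_pos (Real.exp_pos _), ← Real.exp_sub]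
    congr 2
    ring

/-! ### Sub-Gaussian matrices -/

/-- The variance proxy of the entries of a sub-Gaussian matrix with parameter `c`. -/
noncomputable def proxy (c : ℝ) : NNReal := Real.toNNReal (2 * Real.exp 1 * c ^ 2)

theorem IsSubGaussianMatrix.hasSubgaussianMGF_entry {Ω : Type*} [MeasurableSpace Ω] {P : Measure Ω}
    [IsProbabilityMeasure P] {m k : ℕ} {E : Ω → Matrix (Fin m) (Fin k) ℝ} {c : ℝ}
    (h : IsSubGaussianMatrix P E c 0 1) (i : Fin m) (j : Fin k) :
    HasSubgaussianMGF (fun ω => E ω i j) (proxy c) P :=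
  (h.subGaussian i j).hasSubgaussianMGF (h.measurable i j) (h.mean_eq i j)

theorem IsSubGaussianMatrix.hasSubgaussianMGF_sum {Ω : Type*} [MeasurableSpace Ω] {P : Measure Ω}
    [IsProbabilityMeasure P] {m k : ℕ} {E : Ω → Matrix (Fin m) (Fin k) ℝ} {c : ℝ}
    (h : IsSubGaussianMatrix P E c 0 1) (a : Fin m × Fin k → ℝ) {κ : NNReal}
    (hκ : (κ : ℝ) = (∑ p, a p ^ 2) * proxy c) :
    HasSubgaussianMGF (fun ω => ∑ p, a p * E ω p.1 p.2) κ P := by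
  have h1 := HasSubgaussianMGF.sum_of_iIndepFun (s := Finset.univ)
    (h.indep.comp (fun p x => a p * x) fun p => measurable_const_mul (a p))
    (fun p _ => (h.hasSubgaussianMGF_entry p.1 p.2).const_mul (a p))
  convert h1 using 1
  · rfl
  · apply NNReal.coe_injective
    rw [hκ, Finset.sum_mul]
    push_cast
    rfl

/-- The tail of a linear form of the matrix. -/
theorem IsSubGaussianMatrix.measure_sum_ge_le {Ω : Type*} [MeasurableSpace Ω] {P : Measure Ω}
    [IsProbabilityMeasure P] {m k : ℕ} {E : Ω → Matrix (Fin m) (Fin k) ℝ} {c : ℝ}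
    (h : IsSubGaussianMatrix P E c 0 1) (a : Fin m × Fin k → ℝ) (ha : ∑ p, a p ^ 2 ≤ 1)
    {t : ℝ} (ht : 0 < t) (hc : 0 < (proxy c : ℝ)) :
    P {ω | t ≤ ∑ p, a p * E ω p.1 p.2} ≤
      ENNReal.ofReal (Real.exp (-(t ^ 2 / (2 * proxy c)))) := by
  have hnn : 0 ≤ (∑ p, a p ^ 2) * (proxy c : ℝ) :=
    mul_nonneg (Finset.sum_nonneg fun _ _ => sq_nonneg _) hc.le
  have h1 := h.hasSubgaussianMGF_sum a (κ := ⟨_, hnn⟩) rfl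
  -- The value $t/\kappa$ optimizes the Chernoff exponent $-t\theta+\kappa\theta^2/2$.
  have h2 := ((h1.mgf_le (t / proxy c)).trans (Real.exp_le_exp.2
    (show _ ≤ t ^ 2 / (2 * (proxy c : ℝ)) from ?_)))
  · have h3 := measure_ge_le_exp_mul_mgf (μ := P) t (t := t / proxy c) (by positivity)
      (h1.integrable_exp_mul _)
    rw [← ENNReal.ofReal_toReal (measure_ne_top P _)]
    refine ENNReal.ofReal_le_ofReal (h3.trans ((mul_le_mul_of_nonneg_left h2
      (Real.exp_pos _).le).trans_eq ?_))
    rw [← Real.exp_add]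
    congr 1
    field_simp
    ring
  · have h4 : t ^ 2 / (2 * (proxy c : ℝ)) = proxy c * (t / proxy c) ^ 2 / 2 := by field_simp
    rw [h4]
    have h5 : (∑ p, a p ^ 2) * (proxy c : ℝ) ≤ proxy c := by nlinarith
    change (∑ p, a p ^ 2) * (proxy c : ℝ) * (t / proxy c) ^ 2 / 2 ≤ _
    gcongr

theorem mulVec_apply_eq_sum_prod {m k : ℕ} (A : Matrix (Fin m) (Fin k) ℝ) (x : Fin k → ℝ)
    (i : Fin m) :
    (A *ᵥ x) i = ∑ p : Fin m × Fin k, (if p.1 = i then x p.2 else 0) * A p.1 p.2 := by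
  rw [Fintype.sum_prod_type, Finset.sum_eq_single i]
  · simp [Matrix.mulVec, dotProduct, mul_comm]
  · intro b _ hb
    simp [hb]
  · simp

theorem sum_ite_sq {m k : ℕ} (x : EuclideanSpace ℝ (Fin k)) (i : Fin m) :
    ∑ p : Fin m × Fin k, (if p.1 = i then x p.2 else 0) ^ 2 = ‖x‖ ^ 2 := by
  rw [Fintype.sum_prod_type, Finset.sum_eq_single i, EuclideanSpace.real_norm_sq_eq]
  · simp
  · intro b _ hb
    simp [hb]
  · simp

theorem IsSubGaussianMatrix.measurable_mulVec {Ω : Type*} [MeasurableSpace Ω] {P : Measure Ω}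
    {m k : ℕ} {E : Ω → Matrix (Fin m) (Fin k) ℝ} {c : ℝ}
    (h : IsSubGaussianMatrix P E c 0 1) (x : Fin k → ℝ) (i : Fin m) :
    Measurable fun ω => (E ω *ᵥ x) i := by
  simp only [Matrix.mulVec, dotProduct]
  exact Finset.measurable_sum _ fun j _ => (h.measurable i j).mul_const _

theorem IsSubGaussianMatrix.hasSubgaussianMGF_mulVec {Ω : Type*} [MeasurableSpace Ω]
    {P : Measure Ω} [IsProbabilityMeasure P] {m k : ℕ} {E : Ω → Matrix (Fin m) (Fin k) ℝ} {c : ℝ}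
    (h : IsSubGaussianMatrix P E c 0 1) {x : EuclideanSpace ℝ (Fin k)} (hx : ‖x‖ = 1) (i : Fin m) :
    HasSubgaussianMGF (fun ω => (E ω *ᵥ x.ofLp) i) (proxy c) P := by
  simp only [mulVec_apply_eq_sum_prod]
  exact h.hasSubgaussianMGF_sum _ (by rw [sum_ite_sq, hx]; simp)

/-- Different coordinates of $Ex$ depend on disjoint rows of entries. -/
theorem IsSubGaussianMatrix.indepFun_mulVec {Ω : Type*} [MeasurableSpace Ω]
    {P : Measure Ω} [IsProbabilityMeasure P] {m k : ℕ} {E : Ω → Matrix (Fin m) (Fin k) ℝ} {c : ℝ}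
    (h : IsSubGaussianMatrix P E c 0 1) (x : Fin k → ℝ) (T : Finset (Fin m)) (j : Fin m)
    (hj : j ∉ T) :
    IndepFun (fun ω (i : T) => (E ω *ᵥ x) i) (fun ω => (E ω *ᵥ x) j) P := by
  classical
  have hdisj : Disjoint (T ×ˢ (Finset.univ : Finset (Fin k))) ({j} ×ˢ Finset.univ) :=
    Finset.disjoint_product.2 (Or.inl (Finset.disjoint_singleton_right.2 hj))
  have h1 := h.indep.indepFun_finset _ _ hdisj fun p => h.measurable p.1 p.2
  have hφ : Measurable fun (u : ↥(T ×ˢ (Finset.univ : Finset (Fin k))) → ℝ) (i : T) =>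
      ∑ l : Fin k, u ⟨(i, l), Finset.mk_mem_product i.2 (Finset.mem_univ l)⟩ * x l :=
    measurable_pi_lambda _ fun i => Finset.measurable_sum _ fun l _ =>
      (measurable_pi_apply _).mul_const _
  have hψ : Measurable fun (u : ↥({j} ×ˢ (Finset.univ : Finset (Fin k))) → ℝ) =>
      ∑ l : Fin k, u ⟨(j, l), Finset.mk_mem_product (Finset.mem_singleton_self j)
        (Finset.mem_univ l)⟩ * x l :=
    Finset.measurable_sum _ fun l _ => (measurable_pi_apply _).mul_const _
  exact h1.comp hφ hψ

theorem IsSubGaussianMatrix.integral_mulVec_sq {Ω : Type*} [MeasurableSpace Ω]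
    {P : Measure Ω} [IsProbabilityMeasure P] {m k : ℕ} {E : Ω → Matrix (Fin m) (Fin k) ℝ} {c : ℝ}
    (h : IsSubGaussianMatrix P E c 0 1) {x : EuclideanSpace ℝ (Fin k)} (hx : ‖x‖ = 1) (i : Fin m) :
    ∫ ω, (E ω *ᵥ x.ofLp) i ^ 2 ∂P = 1 := by
  have hint : ∀ j, Integrable (fun ω => E ω i j) P := fun j =>
    (h.hasSubgaussianMGF_entry i j).integrable
  have hmean : ∫ ω, (E ω *ᵥ x.ofLp) i ∂P = 0 := by
    simp only [Matrix.mulVec, dotProduct]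
    rw [integral_finsetSum _ fun j _ => (hint j).mul_const _]
    simp [integral_mul_const, h.mean_eq]
  rw [← variance_of_integral_eq_zero (h.measurable_mulVec x.ofLp i).aemeasurable hmean]
  have h1 : (fun ω => (E ω *ᵥ x.ofLp) i) = ∑ j : Fin k, fun ω => x j * E ω i j := by
    funext ω
    simp [Matrix.mulVec, dotProduct, mul_comm]
  rw [h1, IndepFun.variance_sum]
  · simp only [variance_const_mul, h.variance_eq, mul_one]
    rw [← EuclideanSpace.real_norm_sq_eq, hx, one_pow]
  · intro j _
    have := (h.hasSubgaussianMGF_entry i j).memLp 2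
    exact (show MemLp (fun ω => E ω i j) 2 P by simpa using this).const_mul (x j)
  · intro j _ l _ hjl
    have h2 : IndepFun (fun ω => E ω i j) (fun ω => E ω i l) P :=
      h.indep.indepFun (i := (i, j)) (j := (i, l)) (by simpa using hjl)
    exact h2.comp (measurable_const_mul (x j)) (measurable_const_mul (x l))

/-! ### The matrix seen through an orthonormal family -/

/-- The coefficient of the `i`-th coordinate vector in the family `w`. -/
noncomputable def coordVec {m n : ℕ} (w : Fin n → EuclideanSpace ℝ (Fin m)) (i : Fin m) :
    EuclideanSpace ℝ (Fin n) :=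
  WithLp.toLp 2 fun a => w a i

/-- `x ↦ (⟪w_a, A x⟫)_a`. -/
noncomputable def compress {m n k : ℕ} (w : Fin n → EuclideanSpace ℝ (Fin m))
    (A : Matrix (Fin m) (Fin k) ℝ) : EuclideanSpace ℝ (Fin k) →ₗ[ℝ] EuclideanSpace ℝ (Fin n) where
  toFun x := ∑ i, (A *ᵥ x.ofLp) i • coordVec w i
  map_add' x y := by
    simp only [WithLp.ofLp_add, Matrix.mulVec_add, Pi.add_apply, add_smul, Finset.sum_add_distrib]
  map_smul' t x := by
    simp only [WithLp.ofLp_smul, Matrix.mulVec_smul, Pi.smul_apply, smul_eq_mul, mul_smul,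
      Finset.smul_sum, RingHom.id_apply]

theorem compress_apply {m n k : ℕ} (w : Fin n → EuclideanSpace ℝ (Fin m))
    (A : Matrix (Fin m) (Fin k) ℝ) (x : EuclideanSpace ℝ (Fin k)) :
    compress w A x = ∑ i, (A *ᵥ x.ofLp) i • coordVec w i := rfl

theorem inner_coordVec {m n : ℕ} (w : Fin n → EuclideanSpace ℝ (Fin m)) (i : Fin m)
    (y : EuclideanSpace ℝ (Fin n)) : inner ℝ (coordVec w i) y = (∑ a, y a • w a) i := by
  simp [PiLp.inner_apply, coordVec]

theorem norm_sum_smul_sq {m n : ℕ} {w : Fin n → EuclideanSpace ℝ (Fin m)} (hw : Orthonormal ℝ w)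
    (y : EuclideanSpace ℝ (Fin n)) : ‖∑ a, y a • w a‖ ^ 2 = ‖y‖ ^ 2 := by
  rw [← real_inner_self_eq_norm_sq, hw.inner_sum, EuclideanSpace.real_norm_sq_eq]
  exact Finset.sum_congr rfl fun a _ => by rw [conj_trivial, pow_two]

/-- The map $y\mapsto\sum_ay_aw_a$ is an isometry with rows `coordVec w i`, so these form a Parseval
frame. Their squared norms sum to the trace $n$, the exponent in the small-ball estimate. -/
theorem sum_inner_coordVec_sq {m n : ℕ} {w : Fin n → EuclideanSpace ℝ (Fin m)}
    (hw : Orthonormal ℝ w) (y : EuclideanSpace ℝ (Fin n)) :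
    ∑ i, (inner ℝ (coordVec w i) y) ^ 2 = ‖y‖ ^ 2 := by
  simp only [inner_coordVec]
  rw [← EuclideanSpace.real_norm_sq_eq, norm_sum_smul_sq hw]

theorem sum_norm_coordVec_sq {m n : ℕ} {w : Fin n → EuclideanSpace ℝ (Fin m)}
    (hw : Orthonormal ℝ w) : ∑ i, ‖coordVec w i‖ ^ 2 = n := by
  simp only [EuclideanSpace.real_norm_sq_eq, coordVec]
  rw [Finset.sum_comm]
  simp only [← EuclideanSpace.real_norm_sq_eq, hw.1]
  simp

theorem inner_compress {m n k : ℕ} (w : Fin n → EuclideanSpace ℝ (Fin m))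
    (A : Matrix (Fin m) (Fin k) ℝ) (x : EuclideanSpace ℝ (Fin k)) (y : EuclideanSpace ℝ (Fin n)) :
    inner ℝ y (compress w A x) = ∑ i, (A *ᵥ x.ofLp) i * (∑ a, y a • w a) i := by
  rw [compress_apply, inner_sum]
  refine Finset.sum_congr rfl fun i _ => ?_
  rw [real_inner_smul_right, real_inner_comm, inner_coordVec]

/-- The smoothed matrix is bounded below by the compression to low frequencies. -/
theorem norm_compress_le {m n k r : ℕ} {w : Fin n → EuclideanSpace ℝ (Fin m)}
    (hw : Orthonormal ℝ w) {β : ℝ} (hβ0 : 0 ≤ β)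
    (hβ : ∀ v ∈ Submodule.span ℝ (Set.range w),
        ‖WithLp.toLp 2 (((diffMatrix m)ᵀ ^ r) *ᵥ v.ofLp)‖ ≤ β * ‖v‖)
    (A : Matrix (Fin m) (Fin k) ℝ) (x : EuclideanSpace ℝ (Fin k)) :
    ‖compress w A x‖ ≤ β * ‖WithLp.toLp 2 (((diffMatrix m ^ r)⁻¹ * A) *ᵥ x.ofLp)‖ := by
  set y := compress w A x with hy
  set v := ∑ a, y a • w a with hv
  have hvn : ‖v‖ = ‖y‖ := by
    have := norm_sum_smul_sq hw y
    exact (pow_left_inj₀ (norm_nonneg _) (norm_nonneg _) two_ne_zero).1 this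
  have hvmem : v ∈ Submodule.span ℝ (Set.range w) :=
    Submodule.sum_mem _ fun a _ => Submodule.smul_mem _ _ (Submodule.subset_span ⟨a, rfl⟩)
  set B := ((diffMatrix m ^ r)⁻¹ * A) *ᵥ x.ofLp with hB
  have h1 : A *ᵥ x.ofLp = (diffMatrix m ^ r) *ᵥ B := by
    rw [hB, Matrix.mulVec_mulVec, ← Matrix.mul_assoc,
      Matrix.mul_nonsing_inv _ (isUnit_diffMatrix_pow m r), Matrix.one_mul]
  have h2 : ‖y‖ ^ 2 = inner ℝ (WithLp.toLp 2 (((diffMatrix m)ᵀ ^ r) *ᵥ v.ofLp))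
      (WithLp.toLp 2 B) := by
    rw [← real_inner_self_eq_norm_sq]
    conv_lhs => rw [hy, inner_compress, ← hy, ← hv, h1]
    change (diffMatrix m ^ r *ᵥ B) ⬝ᵥ v.ofLp = _
    rw [EuclideanSpace.inner_toLp_toLp, ← Matrix.transpose_pow, Matrix.mulVec_transpose,
      dotProduct_comm, Matrix.dotProduct_mulVec, dotProduct_comm]
    simp
  have h3 : ‖y‖ ^ 2 ≤ β * ‖y‖ * ‖WithLp.toLp 2 B‖ := by
    rw [h2]
    refine (real_inner_le_norm _ _).trans ?_
    rw [← hvn]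
    exact mul_le_mul_of_nonneg_right (hβ v hvmem) (norm_nonneg _)
  by_cases hy0 : ‖y‖ = 0
  · rw [hy0]; positivity
  · have : 0 < ‖y‖ := lt_of_le_of_ne (norm_nonneg _) (Ne.symm hy0)
    nlinarith

/-! ### Tail events -/

theorem sum_mul_sq_prod {m k : ℕ} (v : EuclideanSpace ℝ (Fin m)) (x : EuclideanSpace ℝ (Fin k)) :
    ∑ p : Fin m × Fin k, (v p.1 * x p.2) ^ 2 = ‖v‖ ^ 2 * ‖x‖ ^ 2 := by
  simp only [Fintype.sum_prod_type, EuclideanSpace.real_norm_sq_eq, mul_pow, Finset.sum_mul_sum]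

theorem inner_compress_eq_sum {m n k : ℕ} (w : Fin n → EuclideanSpace ℝ (Fin m))
    (A : Matrix (Fin m) (Fin k) ℝ) (x : EuclideanSpace ℝ (Fin k)) (y : EuclideanSpace ℝ (Fin n)) :
    inner ℝ y (compress w A x) =
      ∑ p : Fin m × Fin k, ((∑ a, y a • w a) p.1 * x p.2) * A p.1 p.2 := by
  rw [inner_compress, Fintype.sum_prod_type]
  refine Finset.sum_congr rfl fun i _ => ?_
  rw [Matrix.mulVec, dotProduct, Finset.sum_mul]
  exact Finset.sum_congr rfl fun j _ => by ring

theorem measure_finset_exists_le {Ω ι : Type*} [MeasurableSpace Ω] (P : Measure Ω) (s : Finset ι)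
    {B : Ω → ι → Prop} {q : ℝ}
    (h : ∀ i ∈ s, P {ω | B ω i} ≤ ENNReal.ofReal q) :
    P {ω | ∃ i ∈ s, B ω i} ≤ ENNReal.ofReal (s.card * q) := by
  have h1 : {ω | ∃ i ∈ s, B ω i} = ⋃ i ∈ s, {ω | B ω i} := by ext; simp
  rw [h1]
  refine (measure_biUnion_finset_le s _).trans ((Finset.sum_le_card_nsmul s _ _ h).trans_eq ?_)
  rw [nsmul_eq_mul, ENNReal.ofReal_mul (Nat.cast_nonneg _), ENNReal.ofReal_natCast]

/-- Half-nets in both unit balls reduce the operator norm to $5^{k+n}$ linear forms in the entries,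
each with coefficient vector of norm at most one. -/
theorem IsSubGaussianMatrix.measure_norm_compress_gt_le {Ω : Type*} [MeasurableSpace Ω]
    {P : Measure Ω} [IsProbabilityMeasure P] {m k n : ℕ} {E : Ω → Matrix (Fin m) (Fin k) ℝ} {c : ℝ}
    (h : IsSubGaussianMatrix P E c 0 1) (hc : 0 < (proxy c : ℝ))
    {w : Fin n → EuclideanSpace ℝ (Fin m)} (hw : Orthonormal ℝ w) {t : ℝ} (ht : 0 < t) :
    P {ω | ∃ x, 4 * t * ‖x‖ < ‖compress w (E ω) x‖} ≤
      ENNReal.ofReal (5 ^ (k + n) * Real.exp (-(t ^ 2 / (2 * proxy c)))) := by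
  obtain ⟨s, hs, hs1, hs'⟩ := exists_half_net (EuclideanSpace ℝ (Fin k))
  obtain ⟨u, hu, hu1, hu'⟩ := exists_half_net (EuclideanSpace ℝ (Fin n))
  rw [finrank_euclideanSpace_fin] at hs hu
  have hsub : {ω | ∃ x, 4 * t * ‖x‖ < ‖compress w (E ω) x‖} ⊆
      {ω | ∃ z ∈ s ×ˢ u, t ≤ inner ℝ z.2 (compress w (E ω) z.1)} := by
    rintro ω ⟨x, hx⟩
    by_contra hcon
    simp only [Set.mem_ofPred_eq, not_exists, not_and, not_le] at hcon
    exact absurd (norm_apply_le_of_half_nets hs' hu' (compress w (E ω)) ht.le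
      (fun c hc d hd => (hcon (c, d) (Finset.mk_mem_product hc hd)).le) x) (not_le.2 hx)
  refine (measure_mono hsub).trans ((measure_finset_exists_le P (s ×ˢ u)
    (q := Real.exp (-(t ^ 2 / (2 * proxy c)))) fun z hz => ?_).trans
    (ENNReal.ofReal_le_ofReal ?_))
  · simp only [inner_compress_eq_sum]
    refine h.measure_sum_ge_le _ ?_ ht hc
    obtain ⟨hz1, hz2⟩ := Finset.mem_product.1 hz
    rw [sum_mul_sq_prod, norm_sum_smul_sq hw]
    have h1 := hs1 _ hz1
    have h2 := hu1 _ hz2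
    have h3 : ‖z.1‖ ^ 2 ≤ 1 := pow_le_one₀ (norm_nonneg _) h1
    have h4 : ‖z.2‖ ^ 2 ≤ 1 := pow_le_one₀ (norm_nonneg _) h2
    exact mul_le_one₀ h4 (sq_nonneg _) h3
  · rw [Finset.card_product]
    have : ((s.card * u.card : ℕ) : ℝ) ≤ 5 ^ (k + n) := by
      rw [pow_add]; exact_mod_cast Nat.mul_le_mul hs hu
    exact mul_le_mul_of_nonneg_right this (Real.exp_pos _).le

theorem IsSubGaussianMatrix.measure_norm_row_gt_le {Ω : Type*} [MeasurableSpace Ω]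
    {P : Measure Ω} [IsProbabilityMeasure P] {m k : ℕ} {E : Ω → Matrix (Fin m) (Fin k) ℝ} {c : ℝ}
    (h : IsSubGaussianMatrix P E c 0 1) (hc : 0 < (proxy c : ℝ)) {t : ℝ} (ht : 0 < t) :
    P {ω | ∃ i, 2 * t < ‖WithLp.toLp 2 (E ω i)‖} ≤
      ENNReal.ofReal (m * 5 ^ k * Real.exp (-(t ^ 2 / (2 * proxy c)))) := by
  obtain ⟨s, hs, hs1, hs'⟩ := exists_half_net (EuclideanSpace ℝ (Fin k))
  rw [finrank_euclideanSpace_fin] at hs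
  have hsub : {ω | ∃ i, 2 * t < ‖WithLp.toLp 2 (E ω i)‖} ⊆
      {ω | ∃ z ∈ (Finset.univ : Finset (Fin m)) ×ˢ s, t ≤ (E ω *ᵥ z.2.ofLp) z.1} := by
    rintro ω ⟨i, hi⟩
    by_contra hcon
    simp only [Set.mem_ofPred_eq, not_exists, not_and, not_le] at hcon
    refine absurd (norm_le_of_half_net hs' (fun c hc => ?_)) (not_le.2 hi)
    refine le_trans (le_of_eq ?_)
      (hcon (i, c) (Finset.mk_mem_product (Finset.mem_univ i) hc)).le
    simp [PiLp.inner_apply, Matrix.mulVec, dotProduct]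
  refine (measure_mono hsub).trans ((measure_finset_exists_le P _
    (q := Real.exp (-(t ^ 2 / (2 * proxy c)))) fun z hz => ?_).trans
    (ENNReal.ofReal_le_ofReal ?_))
  · simp only [mulVec_apply_eq_sum_prod]
    refine h.measure_sum_ge_le _ ?_ ht hc
    rw [sum_ite_sq]
    exact pow_le_one₀ (norm_nonneg _) (hs1 _ (Finset.mem_product.1 hz).2)
  · rw [Finset.card_product, Finset.card_univ, Fintype.card_fin]
    have : ((m * s.card : ℕ) : ℝ) ≤ m * 5 ^ k := by
      exact_mod_cast Nat.mul_le_mul le_rfl hs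
    exact mul_le_mul_of_nonneg_right this (Real.exp_pos _).le

theorem IsSubGaussianMatrix.measure_net_norm_compress_le {Ω : Type*} [MeasurableSpace Ω]
    {P : Measure Ω} [IsProbabilityMeasure P] {m k n : ℕ} {E : Ω → Matrix (Fin m) (Fin k) ℝ} {c : ℝ}
    (h : IsSubGaussianMatrix P E c 0 1) {w : Fin n → EuclideanSpace ℝ (Fin m)}
    (hw : Orthonormal ℝ w) {s : ℝ} (hs : 0 < s) (hs1 : 4 * (proxy c : ℝ) * s ≤ 1 / 2)
    (hs2 : s * (48 * Real.exp (proxy c / 2)) ≤ 1 / 2) (N : Finset (EuclideanSpace ℝ (Fin k)))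
    (hN : ∀ x ∈ N, ‖x‖ = 1) :
    P {ω | ∃ x ∈ N, ‖compress w (E ω) x‖ ^ 2 ≤ n / 8} ≤
      ENNReal.ofReal (N.card * Real.exp (-(s / 8 * n))) :=
  measure_finset_exists_le P N fun x hx =>
    measure_norm_sq_sum_smul_le (fun i => h.measurable_mulVec x.ofLp i)
      (h.indepFun_mulVec x.ofLp) (fun i => h.hasSubgaussianMGF_mulVec (hN x hx) i)
      (fun i => h.integral_mulVec_sq (hN x hx) i) hs hs1 hs2 _ (sum_inner_coordVec_sq hw)
      (sum_norm_coordVec_sq hw)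

theorem five_pow_eq_exp (N : ℕ) : (5 : ℝ) ^ N = Real.exp (N * Real.log 5) := by
  rw [mul_comm, Real.exp_mul, Real.exp_log (by norm_num), Real.rpow_natCast]

/-- The compression of a sub-Gaussian matrix to `n ≥ R k` dimensions is bounded below by `√n / 4`,
except on an event of exponentially small probability. -/
theorem exists_measure_compress_lt_le (c : ℝ) (hc : 0 < c) :
    ∃ R ≥ (1 : ℝ), ∃ θ > (0 : ℝ), ∀ {Ω : Type*} [MeasurableSpace Ω] (P : Measure Ω)
      [IsProbabilityMeasure P] (m k n : ℕ) (E : Ω → Matrix (Fin m) (Fin k) ℝ)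
      (w : Fin n → EuclideanSpace ℝ (Fin m)), 0 < n → Orthonormal ℝ w →
      IsSubGaussianMatrix P E c 0 1 → R * k ≤ n →
      P {ω | ∃ x, ‖compress w (E ω) x‖ < √n / 4 * ‖x‖} ≤
        ENNReal.ofReal (2 * Real.exp (-(θ * n))) := by
  have hκ : 0 < (proxy c : ℝ) := by
    rw [proxy, Real.coe_toNNReal _ (by positivity)]
    positivity
  set κ := (proxy c : ℝ) with hκdef
  have hlog : 0 < Real.log 5 := Real.log_pos (by norm_num)
  -- Chosen so that the tail exponent $B^2n/(2\kappa)=(2\log5+1)n$ beats the net size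
  -- $5^{k+n}\le5^{2n}$ and leaves $e^{-n}$.
  set B := √(2 * κ * (2 * Real.log 5 + 1)) with hB
  have hB0 : 0 < B := Real.sqrt_pos.2 (by positivity)
  have hB2 : B ^ 2 = 2 * κ * (2 * Real.log 5 + 1) := Real.sq_sqrt (by positivity)
  -- Mesh $2\cdot2^{-j}$ against operator norm $4B\sqrt n$ loses at most $\sqrt n/10$. On the net
  -- the norm is at least $\frac7{20}\sqrt n$, as $(7/20)^2<1/8$, and
  -- $\frac7{20}-\frac1{10}=\frac14$.
  obtain ⟨j, hj⟩ := exists_pow_lt_of_lt_one (show 0 < 1 / (80 * B) by positivity)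
    (show (1 / 2 : ℝ) < 1 by norm_num)
  set s := 1 / (2 * (4 * κ + 48 * Real.exp (κ / 2))) with hsdef
  have hs : 0 < s := by positivity
  have hs3 : s * (4 * κ + 48 * Real.exp (κ / 2)) = 1 / 2 := by
    rw [hsdef]; field_simp
  have hs1 : 4 * κ * s ≤ 1 / 2 := by nlinarith [Real.exp_pos (κ / 2), mul_pos hs hκ]
  have hs2 : s * (48 * Real.exp (κ / 2)) ≤ 1 / 2 := by nlinarith [mul_pos hs hκ]
  -- This $R$ makes the net size $5^{jk}$ at most $e^{sn/16}$, half of the exponent $sn/8$ available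
  -- at each point.
  refine ⟨max 1 (16 * j * Real.log 5 / s), le_max_left _ _, min 1 (s / 16),
    lt_min one_pos (by positivity), ?_⟩
  intro Ω _ P _ m k n E w hn hw h hR
  have hn0 : (0 : ℝ) < n := Nat.cast_pos.2 hn
  have hkn : (k : ℝ) ≤ n := by
    refine le_trans ?_ hR
    nlinarith [le_max_left 1 (16 * j * Real.log 5 / s), Nat.cast_nonneg (α := ℝ) k]
  have hjk : j * k * Real.log 5 ≤ s / 16 * n := by
    have h1 : 16 * j * Real.log 5 / s * k ≤ n :=
      le_trans (mul_le_mul_of_nonneg_right (le_max_right _ _) (Nat.cast_nonneg k)) hR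
    rw [div_mul_eq_mul_div, div_le_iff₀ hs] at h1
    linarith
  obtain ⟨N, hN, hN1, hN'⟩ := exists_sphere_net (EuclideanSpace ℝ (Fin k)) j
  rw [finrank_euclideanSpace_fin] at hN
  have hsq : (0 : ℝ) < √n := Real.sqrt_pos.2 hn0
  have hsub : {ω | ∃ x, ‖compress w (E ω) x‖ < √n / 4 * ‖x‖} ⊆
      {ω | ∃ x, 4 * (B * √n) * ‖x‖ < ‖compress w (E ω) x‖} ∪
        {ω | ∃ x ∈ N, ‖compress w (E ω) x‖ ^ 2 ≤ n / 8} := by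
    rintro ω ⟨x, hx⟩
    by_contra hcon
    simp only [Set.mem_union, Set.mem_ofPred_eq, not_or, not_exists, not_and, not_lt, not_le] at hcon
    obtain ⟨h1, h2⟩ := hcon
    have h3 : ∀ y ∈ N, √n * (7 / 20) ≤ ‖compress w (E ω) y‖ := by
      intro y hy
      refine abs_le_of_sq_le_sq' ?_ (norm_nonneg _) |>.2
      rw [mul_pow, Real.sq_sqrt hn0.le]
      linarith [h2 y hy]
    have h4 := le_norm_apply_of_sphere_net hN' (compress w (E ω)) (by positivity) h1 h3 x
    have h5 : 4 * (B * √n) * (2 * (1 / 2) ^ j) ≤ √n / 10 := by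
      have h6 : B * (1 / 2) ^ j ≤ 1 / 80 := by
        have := mul_le_mul_of_nonneg_left hj.le hB0.le
        refine this.trans_eq ?_
        field_simp
      nlinarith
    have h7 : √n / 4 * ‖x‖ ≤ (√n * (7 / 20) - 4 * (B * √n) * (2 * (1 / 2) ^ j)) * ‖x‖ :=
      mul_le_mul_of_nonneg_right (by linarith) (norm_nonneg _)
    linarith
  refine (measure_mono hsub).trans ((measure_union_le _ _).trans ((add_le_add
    (h.measure_norm_compress_gt_le hκ hw (mul_pos hB0 hsq))
    (h.measure_net_norm_compress_le hw hs hs1 hs2 N hN1)).trans ?_))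
  rw [← ENNReal.ofReal_add (by positivity) (by positivity)]
  refine ENNReal.ofReal_le_ofReal ?_
  have hE1 : (5 : ℝ) ^ (k + n) * Real.exp (-((B * √n) ^ 2 / (2 * κ))) ≤
      Real.exp (-(min 1 (s / 16) * n)) := by
    rw [five_pow_eq_exp, ← Real.exp_add, mul_pow, hB2, Real.sq_sqrt hn0.le]
    refine Real.exp_le_exp.2 ?_
    have h1 : 2 * κ * (2 * Real.log 5 + 1) * n / (2 * κ) = (2 * Real.log 5 + 1) * n := by
      field_simp
    have h2 : min 1 (s / 16) * n ≤ 1 * n := mul_le_mul_of_nonneg_right (min_le_left _ _) hn0.le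
    rw [h1]
    push_cast
    nlinarith
  have hE2 : N.card * Real.exp (-(s / 8 * n)) ≤ Real.exp (-(min 1 (s / 16) * n)) := by
    have h1 : (N.card : ℝ) ≤ Real.exp (s / 16 * n) := by
      calc (N.card : ℝ) ≤ (5 : ℝ) ^ (j * k) := by exact_mod_cast hN
        _ = Real.exp (j * k * Real.log 5) := by rw [five_pow_eq_exp]; push_cast; rfl
        _ ≤ _ := Real.exp_le_exp.2 hjk
    refine (mul_le_mul_of_nonneg_right h1 (Real.exp_pos _).le).trans ?_
    rw [← Real.exp_add]
    refine Real.exp_le_exp.2 ?_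
    have h2 : min 1 (s / 16) * n ≤ s / 16 * n :=
      mul_le_mul_of_nonneg_right (min_le_right _ _) hn0.le
    linarith
  linarith

/-! ### The reconstruction error -/

/-- An upper bound for `stabConst` when `γ ≥ 3/2`. -/
noncomputable def stabConstBound : ℝ :=
  (⌈Real.pi ^ 2 / Real.arcosh (3 / 2) ^ 2⌉₊ : ℝ) * (Real.exp 1 / Real.pi)

theorem stabConstBound_pos : 0 < stabConstBound := by
  have h : 0 < Real.arcosh (3 / 2) := Real.arcosh_pos (by norm_num)
  have h2 : 0 < ⌈Real.pi ^ 2 / Real.arcosh (3 / 2) ^ 2⌉₊ := Nat.ceil_pos.2 (by positivity)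
  have h3 : (0 : ℝ) < (⌈Real.pi ^ 2 / Real.arcosh (3 / 2) ^ 2⌉₊ : ℝ) := Nat.cast_pos.2 h2
  rw [stabConstBound]
  positivity

theorem stabConst_nonneg (L : ℕ) (δ μ : ℝ) : 0 ≤ stabConst L δ μ := by
  rw [stabConst]; positivity

/-- If $\mu\le\delta L/4$ then $\gamma\ge\frac32L\ge\frac32$, so $C_3$ is bounded by an absolute
constant. Both lower bounds assumed on $\delta$ guarantee this inequality for their own $\mu$. -/
theorem stabConst_le {L : ℕ} (hL : 1 ≤ L) {δ μ : ℝ} (hδ : 0 < δ) (hμ : μ ≤ δ * L / 4) :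
    stabConst L δ μ ≤ stabConstBound := by
  have hL' : (1 : ℝ) ≤ L := by exact_mod_cast hL
  have hγ : 3 / 2 ≤ 2 * L - 2 * μ / δ := by
    have : 2 * μ / δ ≤ L / 2 := by
      rw [div_le_iff₀ hδ]; linarith
    linarith
  have h0 : 0 < Real.arcosh (3 / 2) := Real.arcosh_pos (by norm_num)
  have h1 : Real.arcosh (3 / 2) ≤ Real.arcosh (2 * L - 2 * μ / δ) :=
    (Real.arcosh_le_arcosh (by norm_num) (by linarith)).2 hγ
  rw [stabConst, stabConstBound]
  gcongr

theorem ReconstructsWithin.mono {m k d : ℕ} {Q : ℝ → ℝ} {r : ℕ} {g : Fin (d + 1) → ℝ}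
    {E : Matrix (Fin m) (Fin k) ℝ} {ε ε' : ℝ} (h : ReconstructsWithin Q r g E ε) (hε : ε ≤ ε') :
    ReconstructsWithin Q r g E ε' :=
  ⟨h.1, fun x hx => (h.2 x hx).trans hε⟩

/-- The deterministic error estimate. -/
theorem reconstructsWithin_of_compress {m k n d r L : ℕ} (hm : 0 < m) (hn : 0 < n) {Q : ℝ → ℝ}
    {g : Fin (d + 1) → ℝ} (hg : g 0 = 1) {w : Fin n → EuclideanSpace ℝ (Fin m)}
    (hw : Orthonormal ℝ w)
    (hβ : ∀ v ∈ Submodule.span ℝ (Set.range w),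
        ‖WithLp.toLp 2 (((diffMatrix m)ᵀ ^ r) *ᵥ v.ofLp)‖ ≤ (4 * Real.pi * n / m) ^ r * ‖v‖)
    {E : Matrix (Fin m) (Fin k) ℝ} (hE : ∀ x, √n / 4 * ‖x‖ ≤ ‖compress w E x‖)
    {δ μ A : ℝ} (hδ : 0 < δ) (hA : 0 < A) (hstab : SatisfiesStabilityBound m Q r g L δ μ A)
    (hrow : ∀ i, ‖WithLp.toLp 2 (E i)‖ ≤ √m * μ) :
    ReconstructsWithin Q r g ((1 / √(m : ℝ)) • E)
      (2 * A * δ * (m / √n) * (4 * Real.pi * n / m * stabConst L δ μ * r) ^ r) := by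
  have hm0 : (0 : ℝ) < m := Nat.cast_pos.2 hm
  have hn0 : (0 : ℝ) < n := Nat.cast_pos.2 hn
  have hsm : 0 < √(m : ℝ) := Real.sqrt_pos.2 hm0
  have hsn : 0 < √(n : ℝ) := Real.sqrt_pos.2 hn0
  have hπ := Real.pi_pos
  set b := (4 * Real.pi * n / m) ^ r with hb
  have hb0 : 0 < b := by positivity
  have hsc := stabConst_nonneg L δ μ
  set U := A * stabConst L δ μ ^ r * (r : ℝ) ^ r * (δ / 2) with hU
  have hU0 : 0 ≤ U := by positivity
  -- Lower bound for $D^{-r}E$: normalization of $E$, times that of the compression, divided by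
  -- $\|(D^*)^r|_W\|$.
  set σ := 1 / √(m : ℝ) * (√n / 4) / b with hσ
  have hσ0 : 0 < σ := by positivity
  have hmain := reconstructsWithin_of_bounds Q r g hg ((1 / √(m : ℝ)) • E) hσ0 hU0
    (fun z => ?_) (fun x hx i => ?_)
  · convert hmain using 1
    rw [hσ, hU, mul_pow, mul_pow, ← hb]
    field_simp
    rw [Real.sq_sqrt hm0.le]
    ring
  · have h1 := norm_compress_le hw hb0.le hβ E (WithLp.toLp 2 z)
    have h2 := (hE (WithLp.toLp 2 z)).trans h1
    rw [← norm_toLp_sq, ← norm_toLp_sq, ← mul_pow]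
    refine pow_le_pow_left₀ (by positivity) ?_ 2
    have h3 : WithLp.toLp 2 (((diffMatrix m ^ r)⁻¹ * (1 / √(m : ℝ)) • E) *ᵥ z) =
        (1 / √(m : ℝ)) • WithLp.toLp 2 (((diffMatrix m ^ r)⁻¹ * E) *ᵥ z) := by
      rw [Matrix.mul_smul, Matrix.smul_mulVec, WithLp.toLp_smul]
    rw [h3, norm_smul, Real.norm_of_nonneg (by positivity), hσ, div_mul_eq_mul_div,
      div_le_iff₀ hb0, mul_assoc, mul_assoc]
    refine mul_le_mul_of_nonneg_left ?_ (by positivity)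
    linarith
  · refine hstab _ (fun i => ?_) i
    have h1 : (((1 / √(m : ℝ)) • E) *ᵥ x.ofLp) i =
        1 / √(m : ℝ) * inner ℝ (WithLp.toLp 2 (E i)) x := by
      rw [Matrix.smul_mulVec, Pi.smul_apply, smul_eq_mul, Matrix.mulVec, dotProduct,
        PiLp.inner_apply]
      congr 1
      exact Finset.sum_congr rfl fun j _ => by simp [mul_comm]
    rw [h1, abs_mul, abs_of_pos (by positivity), one_div, inv_mul_le_iff₀ hsm]
    refine (abs_real_inner_le_norm _ _).trans (le_trans ?_ (hrow i))
    exact mul_le_of_le_one_right (norm_nonneg _) hx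

theorem sq_le_mul_exp {a z : ℝ} (ha : 0 < a) (hz : 0 ≤ z) : z ^ 2 ≤ 2 / a ^ 2 * Real.exp (a * z) := by
  have h := Real.quadratic_le_exp_of_nonneg (x := a * z) (by positivity)
  have h2 : (a * z) ^ 2 ≤ 2 * Real.exp (a * z) := by
    have : 0 ≤ a * z := by positivity
    linarith
  rw [div_mul_eq_mul_div, le_div_iff₀ (by positivity)]
  nlinarith

/-- The size of the error for the order `r = ⌊2 C √(m/k)⌋`. -/
theorem error_le {m k n r : ℕ} {z C A δ s : ℝ} (hk : 0 < k) (hz : 1 ≤ z) (hmz : (m : ℝ) = z ^ 2 * k)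
    (hC : 0 < C) (hC2 : 16 * Real.pi * stabConstBound * C ≤ Real.exp (-2)) (hA : 0 < A)
    (hδ : 0 < δ) (hs0 : 0 ≤ s) (hs : s ≤ stabConstBound) (hn1 : k * z ≤ n) (hn2 : n ≤ 2 * (k * z))
    (hr : r = ⌊2 * C * z⌋₊) :
    2 * A * δ * (m / √n) * (4 * Real.pi * n / m * s * r) ^ r ≤
      4 * A * Real.exp 2 / C ^ 2 * √(k : ℝ) * Real.exp (-C * z) * δ := by
  have hπ := Real.pi_pos
  have hK := stabConstBound_pos
  have hk0 : (0 : ℝ) < k := Nat.cast_pos.2 hk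
  have hz0 : 0 < z := by linarith
  have hm0 : (0 : ℝ) < m := by rw [hmz]; positivity
  have hn0 : (0 : ℝ) < n := lt_of_lt_of_le (by positivity) hn1
  have hsn : 0 < √(n : ℝ) := Real.sqrt_pos.2 hn0
  -- Only $n\ge k$ is used; the resulting $z^2$ is later paid for by one factor $e^{Cz}$.
  have h1 : m / √(n : ℝ) ≤ √(k : ℝ) * z ^ 2 := by
    rw [div_le_iff₀ hsn, hmz]
    have h2 : √(k : ℝ) ≤ √n := Real.sqrt_le_sqrt (by nlinarith)
    have h3 : (k : ℝ) = √(k : ℝ) * √k := (Real.mul_self_sqrt hk0.le).symm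
    have h4 : √(k : ℝ) * √k ≤ √k * √n := mul_le_mul_of_nonneg_left h2 (Real.sqrt_nonneg _)
    nlinarith [sq_nonneg z]
  have hrle : (r : ℝ) ≤ 2 * C * z := by
    rw [hr]; exact Nat.floor_le (by positivity)
  have hrge : 2 * C * z - 1 ≤ r := by
    rw [hr]; linarith [Nat.lt_floor_add_one (2 * C * z)]
  have h5 : 4 * Real.pi * n / m * s * r ≤ Real.exp (-2) := by
    have h6 : 4 * Real.pi * n / m ≤ 8 * Real.pi / z := by
      rw [div_le_div_iff₀ hm0 hz0, hmz]
      have := mul_le_mul_of_nonneg_left hn2 (by positivity : 0 ≤ 4 * Real.pi * z)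
      linarith
    calc 4 * Real.pi * n / m * s * r ≤ 8 * Real.pi / z * stabConstBound * (2 * C * z) := by
          gcongr
      _ = 16 * Real.pi * stabConstBound * C := by field_simp; ring
      _ ≤ _ := hC2
  have h7 : (4 * Real.pi * n / m * s * r) ^ r ≤ Real.exp (2 - 4 * (C * z)) := by
    refine (pow_le_pow_left₀ (by positivity) h5 r).trans ?_
    rw [← Real.exp_nat_mul]
    exact Real.exp_le_exp.2 (by linarith)
  have h8 := sq_le_mul_exp hC hz0.le
  calc 2 * A * δ * (m / √n) * (4 * Real.pi * n / m * s * r) ^ r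
      ≤ 2 * A * δ * (√(k : ℝ) * (2 / C ^ 2 * Real.exp (C * z))) * Real.exp (2 - 4 * (C * z)) := by
        gcongr
        exact h1.trans (mul_le_mul_of_nonneg_left h8 (Real.sqrt_nonneg _))
    _ = 4 * A / C ^ 2 * √(k : ℝ) * δ * Real.exp (2 - 3 * (C * z)) := by
        have : Real.exp (2 - 3 * (C * z)) = Real.exp (C * z) * Real.exp (2 - 4 * (C * z)) := by
          rw [← Real.exp_add]; congr 1; ring
        rw [this]; ring
    _ ≤ 4 * A / C ^ 2 * √(k : ℝ) * δ * Real.exp (2 + -C * z) := by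
        gcongr
        nlinarith [mul_pos hC hz0]
    _ = _ := by rw [Real.exp_add]; ring

/-- The bad event is a union over uncountably many $x$ and need not be shown measurable: its
measurable hull has the same measure. -/
theorem withProbExceeding_of_measure_le {Ω : Type*} [MeasurableSpace Ω] {P : Measure Ω}
    [IsProbabilityMeasure P] {S : Ω → Prop} {bad : Set Ω} {q q' : ℝ} (hq0 : 0 ≤ q)
    (hbad : P bad ≤ ENNReal.ofReal q) (hq : q < q') (hS : ∀ ω ∉ bad, S ω) :
    WithProbExceeding P (1 - q') S := by
  refine ⟨(toMeasurable P bad)ᶜ, (measurableSet_toMeasurable P bad).compl, ?_, fun ω hω => ?_⟩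
  · rw [probReal_compl_eq_one_sub (measurableSet_toMeasurable P bad)]
    have : P.real (toMeasurable P bad) ≤ q := by
      rw [Measure.real, measure_toMeasurable]
      exact ENNReal.toReal_le_of_le_ofReal hq0 hbad
    linarith
  · exact hS ω fun h => hω (subset_toMeasurable P bad h)

/-- The rows of a sub-Gaussian matrix are not too long. -/
theorem IsSubGaussianMatrix.measure_row_gt_le_exp {Ω : Type*} [MeasurableSpace Ω]
    {P : Measure Ω} [IsProbabilityMeasure P] {m k : ℕ} {E : Ω → Matrix (Fin m) (Fin k) ℝ} {c : ℝ}
    (h : IsSubGaussianMatrix P E c 0 1) (hc : 0 < (proxy c : ℝ)) {z a T : ℝ} (hk : 0 < k)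
    (hz : 1 ≤ z) (hmz : (m : ℝ) = z ^ 2 * k) (ha : 0 < a) (hac : a * (32 * proxy c) = 1)
    (hT : 0 < T) (hT2 : T ^ 2 = Real.exp 1 * (k * z))
    (hz1 : 2 / a ^ 3 ≤ z) (hz2 : Real.log 5 / a ≤ z) :
    P {ω | ∃ i, T < ‖WithLp.toLp 2 (E ω i)‖} ≤ ENNReal.ofReal (Real.exp (-(a * (k * z)))) := by
  have h1 := h.measure_norm_row_gt_le hc (t := T / 2) (by positivity)
  rw [mul_div_cancel₀ T two_ne_zero] at h1
  refine h1.trans (ENNReal.ofReal_le_ofReal ?_)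
  have hk1 : (1 : ℝ) ≤ k := by exact_mod_cast hk
  have hk0 : (0 : ℝ) < k := by linarith
  have hS : z ≤ k * z := by nlinarith
  set S := (k : ℝ) * z with hSdef
  have hS0 : 0 < S := by linarith
  have hm : (m : ℝ) ≤ Real.exp (a * S + a * S) := by
    have h2 : (m : ℝ) ≤ S ^ 2 := by
      rw [hmz, hSdef]; nlinarith [sq_nonneg z, mul_nonneg hk0.le (sq_nonneg z)]
    have h3 := sq_le_mul_exp ha hS0.le
    have h4 : 2 / a ^ 2 ≤ Real.exp (a * S) := by
      have h5 : 2 / a ^ 2 = a * (2 / a ^ 3) := by field_simp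
      have h6 : a * (2 / a ^ 3) ≤ a * S := mul_le_mul_of_nonneg_left (hz1.trans hS) ha.le
      linarith [Real.add_one_le_exp (a * S)]
    rw [Real.exp_add]
    exact h2.trans (h3.trans (mul_le_mul_of_nonneg_right h4 (Real.exp_pos _).le))
  have h5 : (5 : ℝ) ^ k ≤ Real.exp (a * S) := by
    rw [five_pow_eq_exp]
    rw [div_le_iff₀ ha] at hz2
    refine Real.exp_le_exp.2 ?_
    rw [hSdef]
    nlinarith
  -- With $a=1/(32\kappa)$ the tail exponent is at least $4akz$; the factor $m5^k$ of the union
  -- bound uses up $3akz$ of it once $z$ is large.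
  have h6 : (T / 2) ^ 2 / (2 * proxy c) = 4 * a * (Real.exp 1 * S) := by
    rw [div_pow, hT2, div_eq_iff (by positivity)]
    linear_combination (-(Real.exp 1 * S) / 4) * hac
  have h7 : 1 ≤ Real.exp 1 := Real.one_le_exp zero_le_one
  calc (m : ℝ) * 5 ^ k * Real.exp (-((T / 2) ^ 2 / (2 * proxy c)))
      ≤ Real.exp (a * S + a * S) * Real.exp (a * S) * Real.exp (-(4 * a * S)) := by
        rw [h6]
        gcongr
        nlinarith [mul_pos ha hS0]
    _ = Real.exp (-(a * S)) := by
        rw [← Real.exp_add, ← Real.exp_add]; congr 1; ring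

theorem proxy_pos {c : ℝ} (hc : 0 < c) : 0 < (proxy c : ℝ) := by
  rw [proxy, Real.coe_toNNReal _ (by positivity)]
  positivity

/-- The reconstruction guarantee on an event on which the rows of the matrix are controlled. -/
theorem exists_withProbExceeding_reconstructsWithin (c : ℝ) (hc : 0 < c) :
    ∃ Z ≥ (1 : ℝ), ∃ C > (0 : ℝ), ∃ θ > (0 : ℝ),
      2 / (1 / (32 * proxy c)) ^ 3 ≤ Z ∧ Real.log 5 / (1 / (32 * proxy c)) ≤ Z ∧
      ∀ {Ω : Type*} [MeasurableSpace Ω] (P : Measure Ω) [IsProbabilityMeasure P]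
        (m k : ℕ) (E : Ω → Matrix (Fin m) (Fin k) ℝ) (z : ℝ), 0 < k →
        IsSubGaussianMatrix P E c 0 1 → (m : ℝ) = z ^ 2 * k → Z ≤ z →
      ∀ (L : ℕ) (δ μ A : ℝ) (Q : ℝ → ℝ) (r d : ℕ) (g : Fin (d + 1) → ℝ), 0 < A →
        1 ≤ L → r = ⌊2 * C * z⌋₊ → g 0 = 1 → 0 < δ → μ ≤ δ * L / 4 →
        SatisfiesStabilityBound m Q r g L δ μ A →
      ∀ q : ℝ, 0 ≤ q →
        P {ω | ¬ ∀ i, ‖WithLp.toLp 2 (E ω i)‖ ≤ √m * μ} ≤ ENNReal.ofReal q →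
      ∀ q' : ℝ, 2 * Real.exp (-(θ * (k * z))) + q < q' →
        WithProbExceeding P (1 - q') fun ω => ReconstructsWithin Q r g ((1 / √(m : ℝ)) • E ω)
          (4 * A * Real.exp 2 / C ^ 2 * √(k : ℝ) * Real.exp (-C * z) * δ) := by
  obtain ⟨R, -, θ, hθ, hlow⟩ := exists_measure_compress_lt_le c hc
  set b := 1 / (32 * (proxy c : ℝ))
  have hK := stabConstBound_pos
  have hπ := Real.pi_pos
  set C := min (1 / 2) (Real.exp (-2) / (16 * Real.pi * stabConstBound)) with hCdef
  have hC : 0 < C := lt_min (by norm_num) (by positivity)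
  have hC1 : C ≤ 1 / 2 := min_le_left _ _
  have hC2 : 16 * Real.pi * stabConstBound * C ≤ Real.exp (-2) := by
    have h1 : C ≤ Real.exp (-2) / (16 * Real.pi * stabConstBound) := min_le_right _ _
    rw [le_div_iff₀ (by positivity)] at h1
    linarith
  -- $z\ge8$ gives $4n\le m$, $z\ge R$ gives $n\ge Rk$, and $C\le1/2$ gives $r\le n$. The other two
  -- terms are the thresholds of the row estimate.
  refine ⟨max (max 8 R) (max (2 / b ^ 3) (Real.log 5 / b)),
    le_trans (by norm_num) ((le_max_left 8 R).trans (le_max_left _ _)), C, hC, θ, hθ,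
    (le_max_left _ _).trans (le_max_right _ _), (le_max_right _ _).trans (le_max_right _ _), ?_⟩
  intro Ω _ P _ m k E z hk h hmz hZ L δ μ A Q r d g hA hL hr hg hδ hμ hstab q hq0 hq q' hq'
  have hz8 : 8 ≤ z := ((le_max_left 8 R).trans (le_max_left _ _)).trans hZ
  have hzR : R ≤ z := ((le_max_right 8 R).trans (le_max_left _ _)).trans hZ
  have hk1 : (1 : ℝ) ≤ k := by exact_mod_cast hk
  have hS : z ≤ k * z := by nlinarith
  set n := ⌈(k : ℝ) * z⌉₊ with hn
  have hn1 : k * z ≤ (n : ℝ) := Nat.le_ceil _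
  have hn2 : (n : ℝ) ≤ 2 * (k * z) := by
    have := Nat.ceil_lt_add_one (show 0 ≤ (k : ℝ) * z by linarith)
    linarith
  have hn0 : 0 < n := Nat.ceil_pos.2 (by linarith)
  have hm0 : 0 < m := by
    have : (0 : ℝ) < m := by rw [hmz]; positivity
    exact_mod_cast this
  have h4n : 4 * n ≤ m := by
    have : (4 * n : ℝ) ≤ m := by rw [hmz]; nlinarith
    exact_mod_cast this
  have hrn : r ≤ n := by
    have h1 : (r : ℝ) ≤ 2 * C * z := by rw [hr]; exact Nat.floor_le (by positivity)
    have h2 : (r : ℝ) ≤ n := by nlinarith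
    exact_mod_cast h2
  obtain ⟨w, hw, hβ⟩ := exists_orthonormal_lowFrequency hn0 hrn h4n
  have hbad := hlow P m k n E w hn0 hw h (by nlinarith)
  refine withProbExceeding_of_measure_le (q := 2 * Real.exp (-(θ * (k * z))) + q)
    (bad := {ω | ∃ x, ‖compress w (E ω) x‖ < √n / 4 * ‖x‖} ∪
      {ω | ¬ ∀ i, ‖WithLp.toLp 2 (E ω i)‖ ≤ √m * μ}) (by positivity) ?_ hq' fun ω hω => ?_
  · refine (measure_union_le _ _).trans ?_
    rw [ENNReal.ofReal_add (by positivity) hq0]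
    refine add_le_add (hbad.trans (ENNReal.ofReal_le_ofReal ?_)) hq
    gcongr
  · simp only [Set.mem_union, Set.mem_ofPred_eq, not_or, not_exists, not_lt, not_not] at hω
    exact (reconstructsWithin_of_compress hm0 hn0 hg hw hβ hω.1 hδ hA hstab hω.2).mono
      (error_le hk (by linarith) hmz hC hC2 hA hδ (stabConst_nonneg _ _ _)
        (stabConst_le hL hδ hμ) hn1 hn2 hr)

end SigmaDelta

/-! ### Choice of the constants and the two cases -/

open SigmaDelta in
theorem theorem4p3 (c : ℝ) (hc : 0 < c) :
    ∃ C₁₂ > (0 : ℝ), ∃ C₁₃ > (0 : ℝ), ∃ C₁₄ > (0 : ℝ), ∀ A > (0 : ℝ), ∃ C₁₅ > (0 : ℝ),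
      ∀ (Ω : Type*) [MeasurableSpace Ω] (P : Measure Ω) [IsProbabilityMeasure P]
        (m k : ℕ) (Et : Ω → Matrix (Fin m) (Fin k) ℝ) (lam : ℝ),
        0 < k → IsSubGaussianMatrix P Et c 0 1 → lam = (m : ℝ) / k → C₁₂ ≤ lam →
      ∀ (L : ℕ) (δ : ℝ) (Q : ℝ → ℝ) (r d : ℕ) (g : Fin (d + 1) → ℝ),
        1 ≤ L → IsScalarQuantizer (midrise L δ) Q →
        r = ⌊2 * C₁₃ * lam ^ (1 / 2 : ℝ)⌋₊ → r ≤ d → g 0 = 1 →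
        -- general entries
        (4 * Real.exp (1 / 2) / (lam ^ (1 / 4 : ℝ) * L) < δ →
          SatisfiesStabilityBound m Q r g L δ (Real.exp (1 / 2) * lam ^ (-(1 / 4) : ℝ)) A →
          WithProbExceeding P (1 - 3 * Real.exp (-C₁₄ * √((m : ℝ) * k))) fun ω =>
            ReconstructsWithin Q r g ((1 / √(m : ℝ)) • Et ω)
              (C₁₅ * √(k : ℝ) * Real.exp (-C₁₃ * lam ^ (1 / 2 : ℝ)) * δ)) ∧
        -- entries bounded by `K`
        (∀ K : ℝ, (∀ i j, ∀ᵐ ω ∂P, |Et ω i j| ≤ K) →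
          4 * K / L * lam ^ (-(1 / 2) : ℝ) < δ →
          SatisfiesStabilityBound m Q r g L δ (K * lam ^ (-(1 / 2) : ℝ)) A →
          WithProbExceeding P (1 - 3 * Real.exp (-C₁₄ * √((m : ℝ) * k))) fun ω =>
            ReconstructsWithin Q r g ((1 / √(m : ℝ)) • Et ω)
              (C₁₅ * √(k : ℝ) * Real.exp (-C₁₃ * lam ^ (1 / 2 : ℝ)) * δ)) := by
  obtain ⟨Z, hZ1, C, hC, θ, hθ, hZa, hZb, hmain⟩ :=
    exists_withProbExceeding_reconstructsWithin c hc
  have hκ := proxy_pos hc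
  set a := 1 / (32 * (proxy c : ℝ)) with ha_def
  have ha : 0 < a := by positivity
  have hac : a * (32 * proxy c) = 1 := by rw [ha_def]; field_simp
  -- Halving makes $\eta$ strictly smaller than both rates, which yields the strict probability
  -- inequality; the exponent is $kz=\sqrt{mk}$.
  set η := min θ a / 2 with hη
  have hη0 : 0 < η := by positivity
  have hηθ : η < θ := by linarith [min_le_left θ a]
  have hηa : η < a := by linarith [min_le_right θ a]
  refine ⟨Z ^ 2, by positivity, C, hC, η, hη0, fun A hA =>
    ⟨4 * A * Real.exp 2 / C ^ 2, by positivity, ?_⟩⟩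
  intro Ω _ P _ m k Et lam hk h hlam hlamZ L δ Q r d g hL _ hr _ hg
  have hk0 : (0 : ℝ) < k := Nat.cast_pos.2 hk
  have hL0 : (0 : ℝ) < L := Nat.cast_pos.2 hL
  have hlam0 : 0 < lam := lt_of_lt_of_le (by positivity) hlamZ
  set y := lam ^ (1 / 4 : ℝ) with hy
  have hy0 : 0 < y := Real.rpow_pos_of_pos hlam0 _
  set z := lam ^ (1 / 2 : ℝ) with hz
  have hz0 : 0 < z := Real.rpow_pos_of_pos hlam0 _
  have hyz : y ^ 2 = z := by
    rw [hy, hz, ← Real.rpow_natCast, ← Real.rpow_mul hlam0.le]; norm_num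
  have hzlam : z ^ 2 = lam := by
    rw [hz, ← Real.rpow_natCast, ← Real.rpow_mul hlam0.le]; norm_num
  have hyinv : lam ^ (-(1 / 4) : ℝ) = y⁻¹ := Real.rpow_neg hlam0.le _
  have hzinv : lam ^ (-(1 / 2) : ℝ) = z⁻¹ := Real.rpow_neg hlam0.le _
  have hmz : (m : ℝ) = z ^ 2 * k := by rw [hzlam, hlam]; field_simp
  have hZz : Z ≤ z := by
    rw [← hzlam] at hlamZ
    exact (pow_le_pow_iff_left₀ (by linarith) hz0.le two_ne_zero).1 hlamZ
  have hsm : √(m : ℝ) = z * √k := by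
    rw [hmz, Real.sqrt_mul (sq_nonneg z), Real.sqrt_sq hz0.le]
  have hmk : √((m : ℝ) * k) = k * z := by
    rw [hmz, show z ^ 2 * k * (k : ℝ) = (k * z) ^ 2 by ring, Real.sqrt_sq (by positivity)]
  rw [hyinv, hzinv, hmk]
  have hS : 0 < (k : ℝ) * z := by positivity
  have hexpθ : Real.exp (-(θ * (k * z))) < Real.exp (-η * (k * z)) :=
    Real.exp_lt_exp.2 (by nlinarith)
  have hexpa : Real.exp (-(a * (k * z))) < Real.exp (-η * (k * z)) :=
    Real.exp_lt_exp.2 (by nlinarith)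
  refine ⟨fun hδ hstab => ?_, fun K hK hδ hstab => ?_⟩
  · have hδ0 : 0 < δ := lt_trans (by positivity) hδ
    have hμ : Real.exp (1 / 2) * y⁻¹ ≤ δ * L / 4 := by
      rw [div_lt_iff₀ (by positivity)] at hδ
      rw [← div_eq_mul_inv, div_le_iff₀ hy0]
      linarith
    refine hmain P m k Et z hk h hmz hZz L δ _ A Q r d g hA hL hr hg hδ0 hμ hstab
      (Real.exp (-(a * (k * z)))) (Real.exp_pos _).le ?_ _ (by linarith)
    -- The level $\mu=e^{1/2}\lambda^{-1/4}$ allows squared row norm $m\mu^2=e\,kz$, of the order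
    -- $\sqrt{mk}$ required in the exponent.
    have hT2 : (√(m : ℝ) * (Real.exp (1 / 2) * y⁻¹)) ^ 2 = Real.exp 1 * (k * z) := by
      have he : Real.exp (1 / 2) ^ 2 = Real.exp 1 := by
        rw [← Real.exp_nat_mul]; norm_num
      rw [mul_pow, mul_pow, he, Real.sq_sqrt (Nat.cast_nonneg m), inv_pow, hyz, hmz]
      field_simp
    have hm0 : 0 < √(m : ℝ) := by rw [hsm]; positivity
    have := h.measure_row_gt_le_exp hκ (T := √(m : ℝ) * (Real.exp (1 / 2) * y⁻¹)) hk
      (hZ1.trans hZz) hmz ha hac (by positivity) hT2 (hZa.trans hZz) (hZb.trans hZz)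
    simpa only [not_forall, not_le] using this
  · have hall : ∀ᵐ ω ∂P, ∀ i j, |Et ω i j| ≤ K := ae_all_iff.2 fun i => ae_all_iff.2 (hK i)
    have hm0 : 0 < m := by
      have : (0 : ℝ) < m := by rw [hmz]; positivity
      exact_mod_cast this
    have hK0 : 0 ≤ K := by
      obtain ⟨ω, hω⟩ := hall.exists
      exact (abs_nonneg _).trans (hω ⟨0, hm0⟩ ⟨0, hk⟩)
    have hδ0 : 0 < δ := lt_of_le_of_lt (by positivity) hδ
    have hμ : K * z⁻¹ ≤ δ * L / 4 := by
      have h1 : 4 * K / L * z⁻¹ * L < δ * L := mul_lt_mul_of_pos_right hδ hL0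
      have h2 : 4 * K / L * z⁻¹ * L = 4 * (K * z⁻¹) := by field_simp
      linarith
    -- Bounded entries give rows of norm at most $\sqrt k\,K=\sqrt m\,K\lambda^{-1/2}$ almost
    -- surely, so the row event fails with probability zero.
    refine hmain P m k Et z hk h hmz hZz L δ _ A Q r d g hA hL hr hg hδ0 hμ hstab 0 le_rfl ?_ _
      (by linarith [Real.exp_pos (-η * (k * z))])
    have hrows : ∀ᵐ ω ∂P, ∀ i, ‖WithLp.toLp 2 (Et ω i)‖ ≤ √(m : ℝ) * (K * z⁻¹) := by
      filter_upwards [hall] with ω hω i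
      have h1 : √(m : ℝ) * (K * z⁻¹) = √k * K := by rw [hsm]; field_simp
      rw [h1]
      refine abs_le_of_sq_le_sq' ?_ (by positivity) |>.2
      rw [EuclideanSpace.real_norm_sq_eq, mul_pow, Real.sq_sqrt hk0.le]
      calc ∑ j, (Et ω i j) ^ 2 ≤ ∑ _j : Fin k, K ^ 2 :=
            Finset.sum_le_sum fun j _ => sq_le_sq' (abs_le.1 (hω i j)).1 (abs_le.1 (hω i j)).2
        _ = k * K ^ 2 := by simp
    rw [ae_iff] at hrows
    rw [hrows]
    exact zero_le
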